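/- Let $k\ge 1$. Take the $(2^k+1)\times(2^k+1)$ grid $\mathfrak G$, with vertices $(r,c)$, $0\le r,c\le 2^k$, where $(r,c)$ and $(r',c')$ are adjacent iff $|r-r'|+|c-c'|=1$. Write $n_j=(j,0)$ for the vertices of the left border, from top to bottom, and $r_j=(j,2^k)$ for those of the right border. Let $G$ be obtained from $\mathfrak G$ by adding the following edges (no new vertices): - for every $2\le i\le k$, with $j=3\cdot 2^{k-i}$, the edges $n_{j-m}n_{j+m}$ for $1\le m\le 2^{k-i}-1$; - with $j=2^{k-1}$, the edges $r_{j-m}r_{j+m}$ for $1\le m\le 2^{k-1}$ (the last one being $r_0r_{2^k}$). The terminals are $s_i=n_{2^{k-i}}$ for $0\le i\le k$, $t_0=n_0$, $t_1=r_{2^{k-1}}$, and $t_i=n_{3\cdot 2^{k-i}}$ for $2\le i\le k$. A solution is a family of pairwise vertex-disjoint paths $P_0,\dots,P_k$ in $G$ such that $P_i$ has endpoints $s_i$ and $t_i$. A vertex $(r,c)$ is *inner* if $0<r<2^k$ and $0<c<2^k$. A path crosses the grid if it contains an inner vertex and neither of its endpoints is inner; the number of times a path crosses the grid is the largest $m$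 such that it can be split into $m$ consecutive paths (each starting at the vertex where the previous one ends), each of which crosses the grid, and it is $0$ if there is no such splitting. **Theorem.** This disjoint paths problem has exactly one solution $P_0,\dots,P_k$. Every vertex of $G$ lies on one of the paths $P_i$. The path $P_0$ does not cross the grid, $P_i$ crosses it exactly $2^{i-1}$ times for $1\le i\le k$, and so the grid is crossed $2^k-1$ times in total. -/

import Mathlib

/-- A family `P` of paths, `P i` from `s i` to `t i`, solves the disjoint paths problem with
terminal pairs `(s i, t i)` if the paths are pairwise vertex disjoint. -/
def IsDisjointPathsSolution {V ι : Type*} {G : SimpleGraph V} {s t : ι → V}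
    (P : ∀ i, G.Path (s i) (t i)) : Prop :=
  Pairwise fun i j => List.Disjoint (P i).1.support (P j).1.support

/-- With `I` the set of inner vertices of a grid contained in `G`: a path crosses the grid if
it contains an inner vertex while its two endpoints are not inner vertices. -/
def Crosses {V : Type*} {G : SimpleGraph V} (I : Set V) {u v : V} (w : G.Walk u v) : Prop :=
  u ∉ I ∧ v ∉ I ∧ ∃ x ∈ w.support, x ∈ I

/-- `CrossesTimes I m w` (for `m ≥ 1`): the path `w` can be split into `m` consecutive paths,
each starting at the vertex where the previous one ends, and each crossing the grid. -/
inductive CrossesTimes {V : Type*} {G : SimpleGraph V} (I : Set V) :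
    ℕ → ∀ {u v : V}, G.Walk u v → Prop
  | one {u v : V} (w : G.Walk u v) : Crosses I w → CrossesTimes I 1 w
  | append {m : ℕ} {u v x : V} (w : G.Walk u v) (w' : G.Walk v x) :
      Crosses I w → CrossesTimes I m w' → CrossesTimes I (m + 1) (w.append w')

/-- The number of times a path crosses the grid: the largest `m` such that the path can be split
into `m` crossing paths, and `0` if there is no such splitting. -/
noncomputable def crossingNumber {V : Type*} {G : SimpleGraph V} (I : Set V) {u v : V}
    (w : G.Walk u v) : ℕ :=
  sSup {m | CrossesTimes I m w}

theorem Crosses.length_pos {V : Type*} {G : SimpleGraph V} {I : Set V} {u v : V}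
    {w : G.Walk u v} (h : Crosses I w) : 1 ≤ w.length := by
  obtain ⟨hu, -, x, hx, hxI⟩ := h
  cases w with
  | nil =>
    rw [SimpleGraph.Walk.support_nil, List.mem_singleton] at hx
    exact absurd (hx ▸ hxI) hu
  | cons e p => simp

theorem CrossesTimes.le_length {V : Type*} {G : SimpleGraph V} {I : Set V} {m : ℕ} {u v : V}
    {w : G.Walk u v} (h : CrossesTimes I m w) : m ≤ w.length := by
  induction h with
  | one w hw => exact hw.length_pos
  | append w w' hw _ ih =>
    have := hw.length_pos
    rw [SimpleGraph.Walk.length_append]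
    omega

/-- The supremum in the definition of `crossingNumber` is a maximum. -/
theorem crossingNumber_isGreatest {V : Type*} {G : SimpleGraph V} (I : Set V) {u v : V}
    (w : G.Walk u v) :
    IsGreatest {m | m = 0 ∨ CrossesTimes I m w} (crossingNumber I w) := by
  have hb : BddAbove {m | CrossesTimes I m w} := ⟨w.length, fun _ hm => hm.le_length⟩
  constructor
  · rcases Set.eq_empty_or_nonempty {m | CrossesTimes I m w} with h | h
    · left
      unfold crossingNumber
      rw [h]
      simp
    · exact Or.inr (Nat.sSup_mem h hb)
  · rintro m (rfl | hm)
    · exact Nat.zero_le _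
    · exact le_csSup hb hm

/-- The `m × n` grid; vertices are `(row, column)`, numbered from `0`. -/
def gridGraph (m n : ℕ) : SimpleGraph (Fin m × Fin n) :=
  SimpleGraph.pathGraph m □ SimpleGraph.pathGraph n

/-- The inner vertices of the `m × n` grid in its standard embedding: those that do not lie in
the first or last row or column, that is, not on the outer face. -/
def gridInner (m n : ℕ) : Set (Fin m × Fin n) :=
  {p | 0 < p.1.val ∧ p.1.val + 1 < m ∧ 0 < p.2.val ∧ p.2.val + 1 < n}

/-- Vertex set of the instance: that of the `(2 ^ k + 1) × (2 ^ k + 1)` grid. Row `0` is the top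
row and column `0` the left border, so that `n_j` is `(j, 0)`; the `j`-th vertex of the right
border is `(j, 2 ^ k)`. -/
abbrev InstVertex (k : ℕ) : Type := Fin (2 ^ k + 1) × Fin (2 ^ k + 1)

/-- The terminal `s_i = n_{2 ^ (k - i)}`. -/
def termS (k : ℕ) (i : Fin (k + 1)) : InstVertex k :=
  (⟨2 ^ (k - i.val), Nat.lt_succ_of_le (Nat.pow_le_pow_right (by norm_num) (Nat.sub_le _ _))⟩, 0)

theorem three_mul_two_pow_lt {k i : ℕ} (h0 : i ≠ 0) (h1 : i ≠ 1) (hik : i < k + 1) :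
    3 * 2 ^ (k - i) < 2 ^ k + 1 := by
  have h : 2 ^ k = 2 ^ (k - i) * 2 ^ i := by
    rw [← pow_add]
    congr 1
    omega
  have h4 : 2 ^ 2 ≤ 2 ^ i := Nat.pow_le_pow_right (by norm_num) (by omega)
  rw [h]
  nlinarith [Nat.zero_le (2 ^ (k - i))]

/-- The terminals `t_i`: `t_0 = n_0` is the topmost vertex of the left border, `t_1` is the middle
vertex of the right border, and `t_i = n_{3 * 2 ^ (k - i)}` for `i ≥ 2`. -/
def termT (k : ℕ) (i : Fin (k + 1)) : InstVertex k :=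
  if h0 : i.val = 0 then (0, 0)
  else if h1 : i.val = 1 then
    (⟨2 ^ (k - 1), Nat.lt_succ_of_le (Nat.pow_le_pow_right (by norm_num) (Nat.sub_le _ _))⟩,
      Fin.last _)
  else (⟨3 * 2 ^ (k - i.val), three_mul_two_pow_lt h0 h1 i.isLt⟩, 0)

/-- The edges `n_{j - m} n_{j + m}`, `1 ≤ m ≤ 2 ^ (k - i) - 1`, of the left border that go around
`t_i = n_j`, `j = 3 * 2 ^ (k - i)`, for `2 ≤ i ≤ k`. -/
def LeftDetour (k : ℕ) (p q : InstVertex k) : Prop :=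
  ∃ i m : ℕ, 2 ≤ i ∧ i ≤ k ∧ 1 ≤ m ∧ m ≤ 2 ^ (k - i) - 1 ∧
    p.2 = 0 ∧ q.2 = 0 ∧
    p.1.val + m = 3 * 2 ^ (k - i) ∧ q.1.val = 3 * 2 ^ (k - i) + m

/-- The edges of the right border that go around its middle vertex `t_1`: they join the vertices
in rows `2 ^ (k - 1) - m` and `2 ^ (k - 1) + m`, for `1 ≤ m ≤ 2 ^ (k - 1)`. -/
def RightDetour (k : ℕ) (p q : InstVertex k) : Prop :=
  ∃ m : ℕ, 1 ≤ m ∧ m ≤ 2 ^ (k - 1) ∧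
    p.2 = Fin.last _ ∧ q.2 = Fin.last _ ∧
    p.1.val + m = 2 ^ (k - 1) ∧ q.1.val = 2 ^ (k - 1) + m

/-- The graph of the instance: the `(2 ^ k + 1) × (2 ^ k + 1)` grid together with the edges
going around the terminals `t_1, …, t_k`. -/
def instGraph (k : ℕ) : SimpleGraph (InstVertex k) :=
  gridGraph (2 ^ k + 1) (2 ^ k + 1) ⊔
    SimpleGraph.fromRel fun p q => LeftDetour k p q ∨ RightDetour k p q

/-! Give the path `P_i` the level `a = k - i` and a generator `x_a` of a free group. For each gap
between adjacent columns, read from top to bottom the horizontal edges that the paths use: `x_a` for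
a step to the right, `x_a⁻¹` for a step to the left, nothing for an unused edge. The letters around
any vertex multiply to `1`, so sweeping over a column preserves the product in the free group. Each
vertex of the left or right border has at most one further connection outside the grid, an
additional edge or the virtual end of a path at a terminal. Reading these outer slots gives a left
and a right border word with the same product (`IsFlow.mk_wordOn_column`).

The right border is symmetric about the end of the path of level `k - 1`, so its word is a conjugate
of `x_(k-1)`. In the left word the rows around `3 * 2 ^ a` contribute a conjugate of `x_a⁻¹`.
Killing high generators, one level at a time from the top, shows that the rows strictly between `0`
and `2 ^ (a + 1)` give, modulo levels above `a`, a conjugate of `x_a` whose conjugator is read off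
the rows between `2 * 2 ^ a` and `3 * 2 ^ a`. Going up again, the word of the lower rows is already
known; it is reduced and as long as the number of rows permits, so the equality in the free group is
an equality letter by letter and fixes the next rows (`IsLeftWord.eq_dyadicLetter`).

Hence every row has a forced nontrivial letter, given by its `2`-adic valuation and its odd part
modulo `4`. The full left word is reduced with one letter per row, so all gap words and the right
word coincide with it. Each row is thus traversed completely by one path in one direction, which
determines the successor of every vertex: solutions are unique and cover the graph. Conversely,
following this successor from each source ends at the right target, which gives existence. Finally,
a path crosses the grid once for each inner row of its level. -/

/-! ### Rigidity of reduced words of maximal length. -/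

theorem FreeGroup.eq_of_mk_eq_of_isReduced {α : Type*} [DecidableEq α] {L M : List (α × Bool)}
    (h : FreeGroup.mk L = FreeGroup.mk M) (hM : FreeGroup.IsReduced M)
    (hl : L.length ≤ M.length) : L = M := by
  have h1 : FreeGroup.reduce L = M := by rw [← hM.reduce_eq]; exact FreeGroup.reduce.sound h
  have h2 : M.Sublist L := h1 ▸ (FreeGroup.reduce.red (L := L)).sublist
  exact (h2.eq_of_length_le hl).symm

theorem List.length_flatMap_le_of_le_one {α β : Type*} {f : α → List β}
    (hf : ∀ r, (f r).length ≤ 1) (L : List α) : (L.flatMap f).length ≤ L.length := by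
  induction L with
  | nil => simp
  | cons a L ih =>
    rw [List.flatMap_cons, List.length_append, List.length_cons]
    have := hf a
    omega

/-- If concatenating words of length at most one gives a word of maximal length, then each of
them is the corresponding letter. -/
theorem List.eq_singleton_of_flatMap_eq_map {α β : Type*} {f : α → List β} {g : α → β}
    (hf : ∀ r, (f r).length ≤ 1) {L : List α} (h : L.flatMap f = L.map g) :
    ∀ r ∈ L, f r = [g r] := by
  induction L with
  | nil => simp
  | cons a L ih =>
    rw [List.flatMap_cons, List.map_cons] at h
    have h1 := hf a
    have h2 := List.length_flatMap_le_of_le_one hf L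
    have h3 := congrArg List.length h
    simp only [List.length_append, List.length_cons, List.length_map] at h3
    obtain ⟨x, hx⟩ := List.length_eq_one_iff.1 (show (f a).length = 1 by omega)
    rw [hx, List.singleton_append, List.cons.injEq] at h
    intro r hr
    rcases List.mem_cons.1 hr with rfl | hr
    · rw [hx, h.1]
    · exact ih h.2 r hr

/-! ### Dyadic letters of the rows. -/

/-- The letter of row `r > 0`: the `2`-adic valuation of `r`, with the sign that tells whether the
odd part of `r` is `1` modulo `4`. -/
def dyadicLetter (r : ℕ) : ℕ × Bool :=
  (padicValNat 2 r, decide (r / 2 ^ padicValNat 2 r % 4 = 1))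

theorem exists_two_pow_mul_odd {r : ℕ} (hr : 0 < r) : ∃ b q, q % 2 = 1 ∧ r = 2 ^ b * q := by
  obtain ⟨b, q, hq, h⟩ := Nat.exists_eq_two_pow_mul_odd hr.ne'
  exact ⟨b, q, Nat.odd_iff.1 hq, h⟩

theorem dyadicLetter_mul {b q : ℕ} (hq : q % 2 = 1) :
    dyadicLetter (2 ^ b * q) = (b, decide (q % 4 = 1)) := by
  have h0 : q ≠ 0 := by rintro rfl; simp at hq
  have h : padicValNat 2 (2 ^ b * q) = b := by
    rw [padicValNat.mul (by positivity) h0, padicValNat.prime_pow,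
      padicValNat.eq_zero_of_not_dvd (by omega), add_zero]
  unfold dyadicLetter
  rw [h, Nat.mul_div_cancel_left _ (by positivity)]

theorem dyadicLetter_two_pow (a : ℕ) : dyadicLetter (2 ^ a) = (a, true) := by
  simpa using dyadicLetter_mul (b := a) (q := 1) rfl

theorem dyadicLetter_three_mul_two_pow (a : ℕ) : dyadicLetter (3 * 2 ^ a) = (a, false) := by
  simpa [mul_comm] using dyadicLetter_mul (b := a) (q := 3) rfl

/-- A number strictly between two consecutive multiples of `2 ^ c` has an odd part and a
valuation below `c`. -/
theorem lt_of_two_pow_mul_between {b q c n : ℕ} (h1 : 2 ^ c * n < 2 ^ b * q)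
    (h2 : 2 ^ b * q < 2 ^ c * (n + 1)) : b < c := by
  by_contra hbc
  push Not at hbc
  obtain ⟨d, rfl⟩ := Nat.exists_eq_add_of_le hbc
  rw [pow_add, mul_assoc] at h1 h2
  have h3 := Nat.lt_of_mul_lt_mul_left h1
  have h4 := Nat.lt_of_mul_lt_mul_left h2
  omega

theorem dyadicLetter_fst_lt {j r : ℕ} (h0 : 0 < r) (hr : r < 2 ^ j) :
    (dyadicLetter r).1 < j := by
  obtain ⟨b, q, hq, rfl⟩ := exists_two_pow_mul_odd h0
  rw [dyadicLetter_mul hq]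
  exact lt_of_two_pow_mul_between (n := 0) (by simpa using h0) (by simpa using hr)

/-- The valuation of `r` is below `j`, so the shift by `2 ^ (j + 1)` adds a multiple of `4` to the
odd part. -/
theorem dyadicLetter_add {j r : ℕ} (h0 : 0 < r) (hr : r < 2 ^ j) :
    dyadicLetter (2 * 2 ^ j + r) = dyadicLetter r := by
  obtain ⟨b, q, hq, rfl⟩ := exists_two_pow_mul_odd h0
  have hb : b < j := lt_of_two_pow_mul_between (n := 0) (by simpa using h0) (by simpa using hr)
  obtain ⟨d, rfl⟩ := Nat.exists_eq_add_of_lt hb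
  have h : 2 * 2 ^ (b + d + 1) + 2 ^ b * q = 2 ^ b * (4 * 2 ^ d + q) := by ring
  rw [h, dyadicLetter_mul hq, dyadicLetter_mul (by omega)]
  congr 2
  simp only [eq_iff_iff]
  omega

/-- Reflection in an odd multiple of `2 ^ c` inverts the letters of the rows that lie closer than
`2 ^ c` to it. -/
theorem dyadicLetter_reflect {c n r r' : ℕ} (h : r + r' = 2 ^ c * (2 * (2 * n + 1)))
    (h1 : 2 ^ c * (2 * n) < r) (h2 : r < 2 ^ c * (2 * n + 2)) (hne : r ≠ r') :
    dyadicLetter r' = ((dyadicLetter r).1, !(dyadicLetter r).2) := by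
  obtain ⟨b, q, hq, rfl⟩ := exists_two_pow_mul_odd (show 0 < r by omega)
  have hb : b < c := by
    rcases lt_trichotomy (2 ^ b * q) (2 ^ c * (2 * n + 1)) with h3 | h3 | h3
    · exact lt_of_two_pow_mul_between h1 h3
    · exfalso; apply hne; rw [h3] at h ⊢
      have : 2 ^ c * (2 * (2 * n + 1)) = 2 ^ c * (2 * n + 1) + 2 ^ c * (2 * n + 1) := by ring
      omega
    · exact lt_of_two_pow_mul_between h3 h2
  obtain ⟨d, rfl⟩ := Nat.exists_eq_add_of_lt hb
  -- The two rows add up to `2 ^ b` times a multiple of `4`, so their odd parts are negatives of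
  -- each other modulo `4`.
  have h4 : 2 ^ (b + d + 1) * (2 * (2 * n + 1)) = 2 ^ b * (4 * (2 ^ d * (2 * n + 1))) := by ring
  have h5 : 2 ^ (b + d + 1) * (2 * n + 2) ≤ 2 ^ (b + d + 1) * (2 * (2 * n + 1)) :=
    Nat.mul_le_mul_left _ (by omega)
  rw [h4] at h h5
  set e := 2 ^ d * (2 * n + 1)
  have h6 : q < 4 * e := Nat.lt_of_mul_lt_mul_left (a := 2 ^ b) (by omega)
  have h7 : r' = 2 ^ b * (4 * e - q) := by rw [Nat.mul_sub]; omega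
  rw [h7, dyadicLetter_mul hq, dyadicLetter_mul (by omega)]
  simp only [Prod.mk.injEq, true_and]
  rw [← decide_not]
  congr 1
  simp only [eq_iff_iff]
  omega

/-- Exactly one of two consecutive rows is odd, that is, has level `0`. This makes words of dyadic
letters reduced. -/
theorem dyadicLetter_fst_ne_succ {r : ℕ} (hr : 0 < r) :
    (dyadicLetter r).1 ≠ (dyadicLetter (r + 1)).1 := by
  have key : ∀ s, 0 < s → ((dyadicLetter s).1 = 0 ↔ s % 2 = 1) := by
    intro s hs
    obtain ⟨b, q, hq, rfl⟩ := exists_two_pow_mul_odd hs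
    rw [dyadicLetter_mul hq]
    rcases b with _ | b
    · simpa using hq
    · simp [pow_succ, Nat.mul_mod]
  have h1 := key r hr
  have h2 := key (r + 1) (by omega)
  intro h
  rw [h, h2] at h1
  omega

/-- The letter of row `r`: the level of the path that runs along row `r` of the grid in a
solution, and whether it does so from left to right. -/
def rowLetter (k r : ℕ) : ℕ × Bool := if r = 0 then (k, false) else dyadicLetter r

theorem rowLetter_zero (k : ℕ) : rowLetter k 0 = (k, false) := rfl

theorem rowLetter_of_pos {k r : ℕ} (hr : 0 < r) : rowLetter k r = dyadicLetter r :=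
  if_neg hr.ne'

theorem isReduced_map_of_fst_ne {α : Type*} {f : ℕ → α × Bool} {s n : ℕ}
    (h : ∀ r, s ≤ r → r + 1 < s + n → (f r).1 ≠ (f (r + 1)).1) :
    FreeGroup.IsReduced ((List.range' s n).map f) := by
  induction n generalizing s with
  | zero => exact FreeGroup.IsReduced.nil
  | succ n ih =>
    rw [List.range'_succ, List.map_cons]
    rcases n with _ | n
    · exact FreeGroup.IsReduced.singleton
    · have := ih (s := s + 1) fun r h1 h2 => h r (by omega) (by omega)
      rw [List.range'_succ, List.map_cons] at this ⊢
      rw [FreeGroup.isReduced_cons_cons]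
      exact ⟨fun h' => absurd h' (h s le_rfl (by omega)), this⟩

theorem rowLetter_fst_ne_succ {k r : ℕ} (hk : 1 ≤ k) :
    (rowLetter k r).1 ≠ (rowLetter k (r + 1)).1 := by
  rcases Nat.eq_zero_or_pos r with rfl | hr
  · rw [rowLetter_zero, rowLetter_of_pos (by omega)]
    have := dyadicLetter_two_pow 0
    rw [pow_zero] at this
    rw [zero_add, this]
    omega
  · rw [rowLetter_of_pos hr, rowLetter_of_pos (by omega)]
    exact dyadicLetter_fst_ne_succ hr

/-! ### The left border word is forced. -/

/-- The endomorphism of the free group that kills all generators from `n` on. -/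
def FreeGroup.truncate (n : ℕ) : FreeGroup ℕ →* FreeGroup ℕ :=
  FreeGroup.lift fun i => if i < n then FreeGroup.of i else 1

theorem FreeGroup.truncate_of {n i : ℕ} :
    FreeGroup.truncate n (FreeGroup.of i) = if i < n then FreeGroup.of i else 1 := by
  simp [FreeGroup.truncate]

theorem FreeGroup.truncate_truncate {m n : ℕ} (h : m ≤ n) (x : FreeGroup ℕ) :
    FreeGroup.truncate m (FreeGroup.truncate n x) = FreeGroup.truncate m x := by
  have : (FreeGroup.truncate m).comp (FreeGroup.truncate n) = FreeGroup.truncate m := by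
    ext i
    simp only [MonoidHom.comp_apply, FreeGroup.truncate_of]
    split_ifs with h1 h2 h2
    · rw [FreeGroup.truncate_of, if_pos h2]
    · rw [FreeGroup.truncate_of, if_neg h2]
    · omega
    · exact _root_.map_one _
  exact DFunLike.congr_fun this x

theorem FreeGroup.truncate_mk (n : ℕ) (L : List (ℕ × Bool)) :
    FreeGroup.truncate n (FreeGroup.mk L) = FreeGroup.mk (L.filter fun x => x.1 < n) := by
  induction L with
  | nil => exact _root_.map_one _
  | cons a L ih =>
    have h : FreeGroup.mk (a :: L) = FreeGroup.mk [a] * FreeGroup.mk L := by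
      rw [FreeGroup.mul_mk]; rfl
    have h1 : FreeGroup.truncate n (FreeGroup.mk [a]) =
        if a.1 < n then FreeGroup.mk [a] else 1 := by
      rcases a with ⟨i, b⟩
      have h2 : FreeGroup.truncate n (FreeGroup.mk [(i, true)]) =
        if i < n then FreeGroup.mk [(i, true)] else 1 := FreeGroup.truncate_of
      cases b
      · have h3 : FreeGroup.mk [(i, false)] = (FreeGroup.mk [(i, true)])⁻¹ := rfl
        rw [h3, _root_.map_inv, h2]
        split_ifs <;> simp
      · exact h2
    rw [h, _root_.map_mul, ih, h1, List.filter_cons]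
    by_cases h3 : a.1 < n
    · simp only [h3, if_true, decide_true]
      rw [FreeGroup.mul_mk]; rfl
    · simp [h3]

/-- The concatenation of the words `l s, …, l (s + n - 1)`. -/
def wordOn (l : ℕ → List (ℕ × Bool)) (s n : ℕ) : List (ℕ × Bool) := (List.range' s n).flatMap l

theorem wordOn_add (l : ℕ → List (ℕ × Bool)) (s m n : ℕ) :
    wordOn l s (m + n) = wordOn l s m ++ wordOn l (s + m) n := by
  unfold wordOn
  rw [← List.flatMap_append, List.range'_append_1]

theorem wordOn_one (l : ℕ → List (ℕ × Bool)) (s : ℕ) : wordOn l s 1 = l s := by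
  simp [wordOn]

theorem wordOn_zero (l : ℕ → List (ℕ × Bool)) (s : ℕ) : wordOn l s 0 = [] := rfl

theorem wordOn_succ (l : ℕ → List (ℕ × Bool)) (s n : ℕ) :
    wordOn l s (n + 1) = wordOn l s n ++ l (s + n) := by
  rw [wordOn_add, wordOn_one]

theorem wordOn_reflect {l : ℕ → List (ℕ × Bool)} {c n : ℕ} (hn : n ≤ c)
    (h : ∀ m, 1 ≤ m → m ≤ n → l (c + m) = FreeGroup.invRev (l (c - m))) :
    wordOn l (c + 1) n = FreeGroup.invRev (wordOn l (c - n) n) := by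
  induction n with
  | zero => rfl
  | succ n ih =>
    have h1 : wordOn l (c - (n + 1)) (n + 1) = l (c - (n + 1)) ++ wordOn l (c - n) n := by
      rw [add_comm n 1, wordOn_add, wordOn_one]
      congr 2
      omega
    rw [wordOn_succ, ih (by omega) fun m h1 h2 => h m h1 (by omega), h1,
      FreeGroup.invRev_append, ← h (n + 1) (by omega) le_rfl, add_assoc, add_comm 1 n]

theorem wordOn_singleton {l : ℕ → List (ℕ × Bool)} {g : ℕ → ℕ × Bool} {s n : ℕ}
    (h : ∀ r, s ≤ r → r < s + n → l r = [g r]) :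
    wordOn l s n = (List.range' s n).map g := by
  unfold wordOn
  rw [← List.flatMap_pure_eq_map]
  apply List.flatMap_congr
  intro r hr
  rw [List.mem_range'_1] at hr
  exact h r hr.1 hr.2

/-- A family of words of length at most one, one for each row, with the given values at the rows of
the terminals of the left border, and inverted by the reflections in the rows of `t_2, …, t_k`. -/
structure IsLeftWord (k : ℕ) (l : ℕ → List (ℕ × Bool)) : Prop where
  length_le : ∀ r, (l r).length ≤ 1
  zero : l 0 = [(k, false)]
  two_pow : ∀ a ≤ k, l (2 ^ a) = [(a, true)]
  three : ∀ a, a + 2 ≤ k → l (3 * 2 ^ a) = [(a, false)]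
  reflect : ∀ a m, a + 2 ≤ k → 1 ≤ m → m < 2 ^ a →
    l (3 * 2 ^ a + m) = FreeGroup.invRev (l (3 * 2 ^ a - m))

theorem mk_singleton_true (a : ℕ) : FreeGroup.mk [(a, true)] = FreeGroup.of a := rfl

theorem mk_singleton_false (a : ℕ) : FreeGroup.mk [(a, false)] = (FreeGroup.of a)⁻¹ := rfl

namespace IsLeftWord

variable {k : ℕ} {l : ℕ → List (ℕ × Bool)}

/-- The rows are cut at the source row `2 * 2 ^ a` and the target row `3 * 2 ^ a`; by reflection,
the rows beyond the target invert those before it. -/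
theorem mk_wordOn_add_two (hl : IsLeftWord k l) {a : ℕ} (ha : a + 2 ≤ k) :
    FreeGroup.mk (wordOn l 1 (2 ^ (a + 2) - 1)) =
      FreeGroup.mk (wordOn l 1 (2 ^ (a + 1) - 1)) * FreeGroup.of (a + 1) *
        (FreeGroup.mk (wordOn l (2 * 2 ^ a + 1) (2 ^ a - 1)) * (FreeGroup.of a)⁻¹ *
          (FreeGroup.mk (wordOn l (2 * 2 ^ a + 1) (2 ^ a - 1)))⁻¹) := by
  have hp : 1 ≤ 2 ^ a := Nat.one_le_two_pow
  have h1 : 2 ^ (a + 2) - 1 =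
      (2 ^ (a + 1) - 1) + (1 + ((2 ^ a - 1) + (1 + (2 ^ a - 1)))) := by
    rw [pow_succ, pow_succ]; omega
  have h2 : 1 + (2 ^ (a + 1) - 1) = 2 ^ (a + 1) := by rw [pow_succ]; omega
  have h3 : 2 ^ (a + 1) + 1 + (2 ^ a - 1) = 3 * 2 ^ a := by rw [pow_succ]; omega
  have h4 : 2 ^ (a + 1) + 1 = 2 * 2 ^ a + 1 := by rw [pow_succ]; omega
  have h5 : 3 * 2 ^ a - (2 ^ a - 1) = 2 * 2 ^ a + 1 := by omega
  rw [h1, wordOn_add, wordOn_add, wordOn_add, wordOn_add, wordOn_one, wordOn_one, h2, h3, h4,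
    wordOn_reflect (c := 3 * 2 ^ a) (by omega)
      (fun m hm1 hm2 => hl.reflect a m ha hm1 (by omega)), h5,
    hl.two_pow (a + 1) (by omega), hl.three a ha]
  simp only [← FreeGroup.mul_mk, ← FreeGroup.inv_mk, mk_singleton_true, mk_singleton_false,
    mul_assoc]

/-- Killing the generators of the higher levels, the word of the rows below `2 ^ (a + 1)` becomes
a conjugate of the generator of level `a`. -/
theorem truncate_mk_wordOn (hl : IsLeftWord k l) (hk : 1 ≤ k)
    (h : ∃ g, FreeGroup.mk (wordOn l 0 (2 ^ k + 1)) = g * FreeGroup.of (k - 1) * g⁻¹)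
    {a : ℕ} (ha : a + 1 ≤ k) :
    ∃ g, FreeGroup.truncate (a + 1) (FreeGroup.mk (wordOn l 1 (2 ^ (a + 1) - 1))) =
      g * FreeGroup.of a * g⁻¹ := by
  obtain ⟨n, hn⟩ := Nat.exists_eq_add_of_le ha
  induction n generalizing a with
  | zero =>
    obtain ⟨g, hg⟩ := h
    have h1 : 2 ^ k + 1 = 1 + ((2 ^ k - 1) + 1) := by
      have : 1 ≤ 2 ^ k := Nat.one_le_two_pow
      omega
    have h2 : 0 + 1 + (2 ^ k - 1) = 2 ^ k := by
      have : 1 ≤ 2 ^ k := Nat.one_le_two_pow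
      omega
    rw [h1, wordOn_add, wordOn_add, wordOn_one, wordOn_one, h2, hl.zero, hl.two_pow k le_rfl] at hg
    obtain rfl : k = a + 1 := by omega
    -- Killing the generator of level `k` removes the letters of rows `0` and `2 ^ k`.
    have hg' := congrArg (FreeGroup.truncate (a + 1)) hg
    simp only [← FreeGroup.mul_mk, mk_singleton_true, mk_singleton_false, map_mul, map_inv,
      FreeGroup.truncate_of, lt_irrefl, if_false, inv_one, one_mul, mul_one,
      Nat.add_sub_cancel, Nat.lt_succ_self, if_true] at hg'
    exact ⟨_, hg'⟩
  | succ n ih =>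
    obtain ⟨g, hg⟩ := ih (a := a + 1) (by omega) (by omega)
    -- Now the generator of level `a + 1` dies as well and its conjugate becomes trivial, so the two
    -- remaining factors of the longer word are inverse to each other.
    have h1 := congrArg (FreeGroup.truncate (a + 1)) hg
    rw [FreeGroup.truncate_truncate (by omega), hl.mk_wordOn_add_two (by omega)] at h1
    simp only [map_mul, map_inv, FreeGroup.truncate_of, lt_irrefl, if_false, mul_one,
      Nat.lt_succ_self, if_true, mul_inv_cancel] at h1
    refine ⟨FreeGroup.truncate (a + 1)
      (FreeGroup.mk (wordOn l (2 * 2 ^ a + 1) (2 ^ a - 1))), ?_⟩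
    rw [eq_inv_of_mul_eq_one_left h1]
    group

/-- This makes the conjugator explicit: it comes from rows not yet known, while the left side
concerns lower rows. Comparing the two is what drives the induction on levels. -/
theorem truncate_mk_wordOn_eq (hl : IsLeftWord k l) (hk : 1 ≤ k)
    (h : ∃ g, FreeGroup.mk (wordOn l 0 (2 ^ k + 1)) = g * FreeGroup.of (k - 1) * g⁻¹)
    {a : ℕ} (ha : a + 2 ≤ k) :
    FreeGroup.truncate (a + 1) (FreeGroup.mk (wordOn l 1 (2 ^ (a + 1) - 1))) =
      FreeGroup.mk ((wordOn l (2 * 2 ^ a + 1) (2 ^ a - 1)).filter (fun x => x.1 < a + 1) ++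
        ([(a, true)] ++ FreeGroup.invRev
          ((wordOn l (2 * 2 ^ a + 1) (2 ^ a - 1)).filter (fun x => x.1 < a + 1)))) := by
  obtain ⟨g, hg⟩ := hl.truncate_mk_wordOn hk h (a := a + 1) (by omega)
  have h1 := congrArg (FreeGroup.truncate (a + 1)) hg
  rw [FreeGroup.truncate_truncate (by omega), hl.mk_wordOn_add_two (by omega)] at h1
  simp only [map_mul, map_inv, FreeGroup.truncate_of, lt_irrefl, if_false, mul_one,
    Nat.lt_succ_self, if_true, mul_inv_cancel] at h1
  rw [eq_inv_of_mul_eq_one_left h1]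
  simp only [← FreeGroup.mul_mk, ← FreeGroup.inv_mk, ← FreeGroup.truncate_mk, mk_singleton_true]
  group

theorem eq_dyadicLetter (hl : IsLeftWord k l) (hk : 1 ≤ k)
    (h : ∃ g, FreeGroup.mk (wordOn l 0 (2 ^ k + 1)) = g * FreeGroup.of (k - 1) * g⁻¹)
    {a : ℕ} (ha : a + 1 ≤ k) {r : ℕ} (h0 : 0 < r) (hr : r < 2 ^ (a + 1)) :
    l r = [dyadicLetter r] := by
  induction a generalizing r with
  | zero =>
    obtain rfl : r = 2 ^ 0 := by rw [pow_zero]; rw [zero_add, pow_one] at hr; omega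
    rw [hl.two_pow 0 (by omega), dyadicLetter_two_pow]
  | succ a ih =>
    have ih' : ∀ r, 1 ≤ r → r < 1 + (2 ^ (a + 1) - 1) → l r = [dyadicLetter r] :=
      fun r h1 h2 => ih (by omega) h1 (by omega)
    have hp : 1 ≤ 2 ^ a := Nat.one_le_two_pow
    have hpow : 2 ^ (a + 1) = 2 * 2 ^ a := by rw [pow_succ, mul_comm]
    have hpow2 : 2 ^ (a + 1 + 1) = 4 * 2 ^ a := by rw [pow_succ, pow_succ]; omega
    have key := hl.truncate_mk_wordOn_eq hk h (a := a) (by omega)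
    -- The known letters all have level at most `a`, so truncation leaves them unchanged.
    rw [wordOn_singleton ih', FreeGroup.truncate_mk, List.filter_eq_self.2] at key
    swap
    · intro x hx
      obtain ⟨r, hr, rfl⟩ := List.mem_map.1 hx
      rw [List.mem_range'_1] at hr
      exact decide_eq_true (dyadicLetter_fst_lt (by omega) (by omega))
    set f : ℕ → List (ℕ × Bool) := fun r => (l r).filter fun x => x.1 < a + 1 with hf
    have hf1 : ∀ r, (f r).length ≤ 1 := fun r => (List.length_filter_le _ _).trans (hl.length_le r)
    have hfw : (wordOn l (2 * 2 ^ a + 1) (2 ^ a - 1)).filter (fun x => x.1 < a + 1) =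
        (List.range' (2 * 2 ^ a + 1) (2 ^ a - 1)).flatMap f := by
      unfold wordOn
      rw [List.filter_flatMap]
    rw [hfw] at key
    have hlen := List.length_flatMap_le_of_le_one hf1 (List.range' (2 * 2 ^ a + 1) (2 ^ a - 1))
    rw [List.length_range'] at hlen
    -- The conjugate has at most `2 * (2 ^ a - 1) + 1 = 2 ^ (a + 1) - 1` letters, exactly the length
    -- of the reduced word it equals.
    have heq := FreeGroup.eq_of_mk_eq_of_isReduced key.symm
      (isReduced_map_of_fst_ne fun r h1 _ => dyadicLetter_fst_ne_succ h1) (by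
        simp only [List.length_append, FreeGroup.invRev_length, List.length_map,
          List.length_range', List.length_singleton]
        omega)
    have hlen2 := congrArg List.length heq
    simp only [List.length_append, FreeGroup.invRev_length, List.length_map,
      List.length_range', List.length_singleton] at hlen2
    have hsplit : (List.range' 1 (2 ^ (a + 1) - 1)).map dyadicLetter =
        (List.range' 1 (2 ^ a - 1)).map dyadicLetter ++
          (List.range' (2 ^ a) (2 ^ a)).map dyadicLetter := by
      rw [← List.map_append]
      congr 1
      have := @List.range'_append_1 1 (2 ^ a - 1) (2 ^ a)
      rw [show 1 + (2 ^ a - 1) = 2 ^ a by omega] at this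
      rw [this]
      congr 1
      omega
    rw [hsplit] at heq
    have heq2 := (List.append_inj heq (by
      rw [List.length_map, List.length_range']; omega)).1
    have hshift : (List.range' 1 (2 ^ a - 1)).map dyadicLetter =
        (List.range' (2 * 2 ^ a + 1) (2 ^ a - 1)).map dyadicLetter := by
      rw [← List.map_add_range', List.map_map]
      apply List.map_congr_left
      intro r hr
      rw [List.mem_range'_1] at hr
      exact (dyadicLetter_add (by omega) (by omega)).symm
    rw [hshift] at heq2
    have hhalf : ∀ r, 2 * 2 ^ a + 1 ≤ r → r < 3 * 2 ^ a → l r = [dyadicLetter r] := by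
      intro r h1 h2
      -- The filtered word of row `r` is nonempty and `l r` has at most one letter, so filtering
      -- removed nothing.
      have h3 := List.eq_singleton_of_flatMap_eq_map hf1 heq2 r
        (List.mem_range'_1.2 ⟨h1, by omega⟩)
      have h4 := hl.length_le r
      have h5 : dyadicLetter r ∈ l r := by
        have : dyadicLetter r ∈ f r := by rw [h3]; exact List.mem_singleton_self _
        exact List.mem_of_mem_filter this
      obtain ⟨x, hx⟩ := List.length_eq_one_iff.1
        (le_antisymm h4 (List.length_pos_of_mem h5))
      rw [hx, List.mem_singleton] at h5
      rw [hx, h5]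
    rcases lt_trichotomy r (2 * 2 ^ a) with h1 | h1 | h1
    · exact ih (by omega) h0 (by omega)
    · rw [h1, ← hpow, hl.two_pow _ (by omega), dyadicLetter_two_pow]
    rcases lt_trichotomy r (3 * 2 ^ a) with h2 | h2 | h2
    · exact hhalf r (by omega) h2
    · rw [h2, hl.three _ (by omega), dyadicLetter_three_mul_two_pow]
    · obtain ⟨m, rfl⟩ := Nat.exists_eq_add_of_lt h2
      rw [add_assoc, hl.reflect a (m + 1) (by omega) (by omega) (by omega),
        hhalf _ (by omega) (by omega),
        dyadicLetter_reflect (c := a) (n := 1) (r := 3 * 2 ^ a - (m + 1))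
          (r' := 3 * 2 ^ a + (m + 1)) (by omega) (by omega) (by omega) (by omega)]
      rfl

theorem eq_rowLetter (hl : IsLeftWord k l) (hk : 1 ≤ k)
    (h : ∃ g, FreeGroup.mk (wordOn l 0 (2 ^ k + 1)) = g * FreeGroup.of (k - 1) * g⁻¹)
    {r : ℕ} (hr : r < 2 ^ k + 1) : l r = [rowLetter k r] := by
  rcases Nat.eq_zero_or_pos r with rfl | h0
  · exact hl.zero
  · rw [rowLetter_of_pos h0]
    rcases (Nat.lt_succ_iff.1 hr).lt_or_eq with h1 | rfl
    · exact hl.eq_dyadicLetter hk h (a := k - 1) (by omega) h0 (by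
        rwa [Nat.sub_add_cancel hk])
    · rw [hl.two_pow k le_rfl, dyadicLetter_two_pow]

/-- Words of length at most one whose product is that of a left word are equal to those of the left
word. -/
theorem eq_rowLetter_of_mk_eq (hl : IsLeftWord k l) (hk : 1 ≤ k)
    (h : ∃ g, FreeGroup.mk (wordOn l 0 (2 ^ k + 1)) = g * FreeGroup.of (k - 1) * g⁻¹)
    {f : ℕ → List (ℕ × Bool)} (hf : ∀ r, (f r).length ≤ 1)
    (hfl : FreeGroup.mk (wordOn f 0 (2 ^ k + 1)) = FreeGroup.mk (wordOn l 0 (2 ^ k + 1)))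
    {r : ℕ} (hr : r < 2 ^ k + 1) : f r = [rowLetter k r] := by
  rw [wordOn_singleton (l := l) (g := rowLetter k)
    fun r _ hr => hl.eq_rowLetter hk h (by omega)] at hfl
  have h1 := FreeGroup.eq_of_mk_eq_of_isReduced hfl
    (isReduced_map_of_fst_ne fun r _ _ => rowLetter_fst_ne_succ hk) (by
      rw [List.length_map]
      exact List.length_flatMap_le_of_le_one hf _)
  exact List.eq_singleton_of_flatMap_eq_map hf h1 r (List.mem_range'_1.2 ⟨by omega, by omega⟩)

end IsLeftWord

/-! ### Flows of disjoint paths and their letters around a vertex. -/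

theorem List.prod_map_eq_of_nodup {α G : Type*} [Group G] {f : α → G} {L : List α} {u : α}
    (hL : L.Nodup) (hu : u ∈ L) (h : ∀ z ∈ L, z ≠ u → f z = 1) : (L.map f).prod = f u := by
  induction L with
  | nil => simp at hu
  | cons a L ih =>
    rw [List.nodup_cons] at hL
    rw [List.map_cons, List.prod_cons]
    rcases List.mem_cons.1 hu with rfl | hu
    · rw [List.prod_eq_one, mul_one]
      intro x hx
      obtain ⟨z, hz, rfl⟩ := List.mem_map.1 hx
      exact h z (List.mem_cons_of_mem _ hz) fun h' => hL.1 (h' ▸ hz)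
    · rw [ih hL.2 hu fun z hz => h z (List.mem_cons_of_mem _ hz),
        h a List.mem_cons_self fun h' => hL.1 (h' ▸ hu), one_mul]

/-- Only two factors matter, and being mutually inverse they cancel in either order. They will be
the edges by which a path enters and leaves a vertex. -/
theorem List.prod_map_eq_one_of_nodup {α G : Type*} [Group G] {f : α → G} {L : List α} {u w : α}
    (hL : L.Nodup) (hu : u ∈ L) (hw : w ∈ L) (huw : u ≠ w) (h1 : f u * f w = 1)
    (h : ∀ z ∈ L, z ≠ u → z ≠ w → f z = 1) : (L.map f).prod = 1 := by
  induction L with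
  | nil => simp at hu
  | cons a L ih =>
    rw [List.nodup_cons] at hL
    rw [List.map_cons, List.prod_cons]
    rcases List.mem_cons.1 hu with rfl | hu'
    · have hw' := (List.mem_cons.1 hw).resolve_left huw.symm
      rw [List.prod_map_eq_of_nodup hL.2 hw' fun z hz hzw =>
        h z (List.mem_cons_of_mem _ hz) (fun h' => hL.1 (h' ▸ hz)) hzw, h1]
    · rcases List.mem_cons.1 hw with rfl | hw
      · rw [List.prod_map_eq_of_nodup hL.2 hu' fun z hz hzu =>
          h z (List.mem_cons_of_mem _ hz) hzu (fun h' => hL.1 (h' ▸ hz))]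
        rw [mul_eq_one_iff_eq_inv] at h1 ⊢
        rw [h1, inv_inv]
      · rw [ih hL.2 hu' hw fun z hz => h z (List.mem_cons_of_mem _ hz),
          h a List.mem_cons_self (fun h' => hL.1 (h' ▸ hu')) (fun h' => hL.1 (h' ▸ hw)), one_mul]

/-- Adjacency in the instance graph, in terms of the coordinates of the vertices. -/
def GridAdj (k : ℕ) (p q : ℕ × ℕ) : Prop :=
  (p.1 ≤ 2 ^ k ∧ p.2 ≤ 2 ^ k ∧ q.1 ≤ 2 ^ k ∧ q.2 ≤ 2 ^ k) ∧
    ((p.1 = q.1 ∧ (p.2 + 1 = q.2 ∨ q.2 + 1 = p.2)) ∨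
      (p.2 = q.2 ∧ (p.1 + 1 = q.1 ∨ q.1 + 1 = p.1)) ∨
      (p.2 = 0 ∧ q.2 = 0 ∧ p.1 ≠ q.1 ∧
        ∃ a, p.1 + q.1 = 6 * 2 ^ a ∧ 2 * 2 ^ a < p.1 ∧ 2 * 2 ^ a < q.1) ∨
      (p.2 = 2 ^ k ∧ q.2 = 2 ^ k ∧ p.1 ≠ q.1 ∧ p.1 + q.1 = 2 ^ k))

theorem GridAdj.symm {k : ℕ} {p q : ℕ × ℕ} (h : GridAdj k p q) : GridAdj k q p := by
  obtain ⟨⟨h1, h2, h3, h4⟩, h⟩ := h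
  refine ⟨⟨h3, h4, h1, h2⟩, ?_⟩
  rcases h with ⟨h, h'⟩ | ⟨h, h'⟩ | ⟨h, h', hne, a, ha, h5, h6⟩ | ⟨h, h', hne, h5⟩
  · exact Or.inl ⟨h.symm, h'.symm⟩
  · exact Or.inr (Or.inl ⟨h.symm, h'.symm⟩)
  · exact Or.inr (Or.inr (Or.inl ⟨h', h, hne.symm, a, by omega, h6, h5⟩))
  · exact Or.inr (Or.inr (Or.inr ⟨h', h, hne.symm, by omega⟩))

/-- The rows of the terminals of the left border. -/
def IsLeftTerminal (r : ℕ) : Prop := r = 0 ∨ (∃ a, r = 2 ^ a) ∨ ∃ a, r = 3 * 2 ^ a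

open Classical in
/-- The other end of the additional edge at row `r` of the left border, if there is one. -/
noncomputable def leftSlot (r : ℕ) : Option (ℕ × ℕ) :=
  if IsLeftTerminal r then none else some (3 * 2 ^ Nat.log 2 r - r, 0)

/-- The other end of the additional edge at row `r` of the right border, if there is one. -/
def rightSlot (k r : ℕ) : Option (ℕ × ℕ) :=
  if 2 * r = 2 ^ k then none else some (2 ^ k - r, 2 ^ k)

theorem leftSlot_two_pow (a : ℕ) : leftSlot (2 ^ a) = none :=
  if_pos (Or.inr (Or.inl ⟨a, rfl⟩))

theorem leftSlot_three (a : ℕ) : leftSlot (3 * 2 ^ a) = none :=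
  if_pos (Or.inr (Or.inr ⟨a, rfl⟩))

theorem leftSlot_zero : leftSlot 0 = none := if_pos (Or.inl rfl)

theorem two_pow_lt_two_pow_iff {a b : ℕ} : 2 ^ a < 2 ^ b ↔ a < b :=
  Nat.pow_lt_pow_iff_right (by norm_num)

theorem leftSlot_eq_some {a r r' : ℕ} (h : r + r' = 6 * 2 ^ a) (hr : 2 * 2 ^ a < r)
    (hr' : 2 * 2 ^ a < r') (hne : r ≠ r') : leftSlot r = some (r', 0) := by
  have hlog : Nat.log 2 r = a + 1 := by
    rw [Nat.log_eq_iff (Or.inl (by omega))]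
    rw [pow_succ, pow_succ]
    omega
  have hnt : ¬ IsLeftTerminal r := by
    rintro (rfl | ⟨b, rfl⟩ | ⟨b, rfl⟩)
    · omega
    · have h1 : 2 ^ (a + 1) < 2 ^ b := by rw [pow_succ]; omega
      have h2 : 2 ^ b < 2 ^ (a + 2) := by rw [pow_succ, pow_succ]; omega
      rw [two_pow_lt_two_pow_iff] at h1 h2
      omega
    · have h1 : 2 ^ a < 2 ^ (b + 1) := by rw [pow_succ]; omega
      have h2 : 2 ^ b < 2 ^ (a + 1) := by rw [pow_succ]; omega
      rw [two_pow_lt_two_pow_iff] at h1 h2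
      obtain rfl : a = b := by omega
      omega
  rw [leftSlot, if_neg hnt, hlog, pow_succ]
  congr 2
  omega

/-- A row of the left border without a terminal has an additional edge. -/
theorem exists_leftSlot_eq_some {r : ℕ} (h : ¬ IsLeftTerminal r) :
    ∃ a r', leftSlot r = some (r', 0) ∧ r + r' = 6 * 2 ^ a ∧ 2 * 2 ^ a < r ∧ 2 * 2 ^ a < r' ∧
      r ≠ r' := by
  have h0 : r ≠ 0 := fun h' => h (Or.inl h')
  have h1 := Nat.pow_log_le_self 2 h0
  have h2 := Nat.lt_pow_succ_log_self (b := 2) (by norm_num) r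
  rcases hL : Nat.log 2 r with _ | a
  · rw [hL] at h1 h2
    exact absurd (Or.inr (Or.inl ⟨0, by simp at h1 h2 ⊢; omega⟩)) h
  · rw [hL] at h1 h2
    have h3 : r ≠ 2 ^ (a + 1) := fun h' => h (Or.inr (Or.inl ⟨_, h'⟩))
    have h4 : r ≠ 3 * 2 ^ a := fun h' => h (Or.inr (Or.inr ⟨_, h'⟩))
    simp only [pow_succ] at h1 h2 h3
    refine ⟨a, 6 * 2 ^ a - r, leftSlot_eq_some (a := a) ?_ ?_ ?_ ?_, ?_, ?_, ?_, ?_⟩ <;>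
      omega

/-- The position of the target of the path of level `a`. -/
def targetPos (k a : ℕ) : ℕ × ℕ :=
  if a = k then (0, 0) else if a + 1 = k then (2 ^ a, 2 ^ k) else (3 * 2 ^ a, 0)

/-- The properties of the relation "the path of level `i` goes from `u` to `v`" of a family of
disjoint directed paths, extended by a virtual vertex `none` before the sources and after the
targets. -/
structure IsFlow (k : ℕ) (D : ℕ → Option (ℕ × ℕ) → Option (ℕ × ℕ) → Prop) : Prop where
  in_unique : ∀ {i j u u' p}, D i u (some p) → D j u' (some p) → i = j ∧ u = u'
  out_unique : ∀ {i j p w w'}, D i (some p) w → D j (some p) w' → i = j ∧ w = w'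
  exists_out : ∀ {i u p}, D i u (some p) → ∃ w, D i (some p) w
  exists_in : ∀ {i p w}, D i (some p) w → ∃ u, D i u (some p)
  not_swap : ∀ {i j u v}, D i u v → ¬ D j v u
  source : ∀ {i p}, D i none (some p) ↔ i ≤ k ∧ p = (2 ^ i, 0)
  target : ∀ {i p}, D i (some p) none ↔ i ≤ k ∧ p = targetPos k i
  adj : ∀ {i p q}, D i (some p) (some q) → GridAdj k p q

open Classical in
/-- The letter of a pair of vertices: which path goes from one to the other, and in which
direction. -/
noncomputable def flowWord (D : ℕ → Option (ℕ × ℕ) → Option (ℕ × ℕ) → Prop)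
    (u v : Option (ℕ × ℕ)) : List (ℕ × Bool) :=
  if h : ∃ i, D i u v then [(h.choose, true)]
  else if h : ∃ i, D i v u then [(h.choose, false)] else []

section Flow

variable {k : ℕ} {D : ℕ → Option (ℕ × ℕ) → Option (ℕ × ℕ) → Prop}

theorem length_flowWord_le (u v : Option (ℕ × ℕ)) : (flowWord D u v).length ≤ 1 := by
  unfold flowWord
  split_ifs <;> simp

theorem of_flowWord_true {i : ℕ} {u v : Option (ℕ × ℕ)} (h : flowWord D u v = [(i, true)]) :
    D i u v := by
  unfold flowWord at h
  split_ifs at h with h1 h2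
  · obtain rfl : h1.choose = i := by simpa using h
    exact h1.choose_spec
  · simp at h

theorem of_flowWord_false {i : ℕ} {u v : Option (ℕ × ℕ)} (h : flowWord D u v = [(i, false)]) :
    D i v u := by
  unfold flowWord at h
  split_ifs at h with h1 h2
  · simp at h
  · obtain rfl : h2.choose = i := by simpa using h
    exact h2.choose_spec

theorem flowWord_eq_nil {u v : Option (ℕ × ℕ)} (h : ∀ i, ¬ D i u v) (h' : ∀ i, ¬ D i v u) :
    flowWord D u v = [] := by
  unfold flowWord
  rw [dif_neg (by simpa using h), dif_neg (by simpa using h')]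

namespace IsFlow

theorem level_unique (hD : IsFlow k D) {i j : ℕ} {u v : Option (ℕ × ℕ)} (h : D i u v)
    (h' : D j u v) : i = j := by
  rcases v with _ | p
  · rcases u with _ | p
    · exact absurd h (hD.not_swap h)
    · exact (hD.out_unique h h').1
  · exact (hD.in_unique h h').1

theorem flowWord_of (hD : IsFlow k D) {i : ℕ} {u v : Option (ℕ × ℕ)} (h : D i u v) :
    flowWord D u v = [(i, true)] := by
  have h1 : ∃ i, D i u v := ⟨i, h⟩
  unfold flowWord
  rw [dif_pos h1, hD.level_unique h1.choose_spec h]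

theorem flowWord_of_swap (hD : IsFlow k D) {i : ℕ} {u v : Option (ℕ × ℕ)} (h : D i v u) :
    flowWord D u v = [(i, false)] := by
  have h1 : ∃ i, D i v u := ⟨i, h⟩
  have h2 : ¬ ∃ i, D i u v := fun ⟨_, h'⟩ => hD.not_swap h h'
  unfold flowWord
  rw [dif_neg h2, dif_pos h1, hD.level_unique h1.choose_spec h]

theorem flowWord_swap (hD : IsFlow k D) (u v : Option (ℕ × ℕ)) :
    flowWord D v u = FreeGroup.invRev (flowWord D u v) := by
  by_cases h1 : ∃ i, D i u v
  · obtain ⟨i, h1⟩ := h1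
    rw [hD.flowWord_of h1, hD.flowWord_of_swap h1]
    rfl
  · by_cases h2 : ∃ i, D i v u
    · obtain ⟨i, h2⟩ := h2
      rw [hD.flowWord_of h2, hD.flowWord_of_swap h2]
      rfl
    · push Not at h1 h2
      rw [flowWord_eq_nil h1 h2, flowWord_eq_nil h2 h1]
      rfl

/-- The product of the letters around a vertex is trivial. -/
theorem prod_flowWord (hD : IsFlow k D) {p : ℕ × ℕ} {L : List (Option (ℕ × ℕ))} (hL : L.Nodup)
    (hc : ∀ i w, D i (some p) w ∨ D i w (some p) → w ∈ L) :
    (L.map fun w => FreeGroup.mk (flowWord D (some p) w)).prod = 1 := by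
  by_cases h : ∃ i u, D i u (some p)
  · obtain ⟨i, u, hu⟩ := h
    obtain ⟨w, hw⟩ := hD.exists_out hu
    refine List.prod_map_eq_one_of_nodup hL (hc i u (Or.inr hu)) (hc i w (Or.inl hw)) ?_ ?_ ?_
    · rintro rfl
      exact hD.not_swap hu hw
    · rw [hD.flowWord_of hw, hD.flowWord_of_swap hu, mk_singleton_false, mk_singleton_true,
        inv_mul_cancel]
    · intro z _ hzu hzw
      rw [flowWord_eq_nil]
      · rfl
      · exact fun j hj => hzw (hD.out_unique hj hw).2
      · exact fun j hj => hzu (hD.in_unique hj hu).2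
  · apply List.prod_eq_one
    intro x hx
    obtain ⟨z, _, rfl⟩ := List.mem_map.1 hx
    rw [flowWord_eq_nil]
    · rfl
    · exact fun j hj => h ⟨j, hD.exists_in hj⟩
    · exact fun j hj => h ⟨j, z, hj⟩

end IsFlow

/-! ### Sweeping over the columns. -/

theorem mk_wordOn_sweep {f g : ℕ → List (ℕ × Bool)} {V : ℕ → FreeGroup ℕ} {n : ℕ} (h0 : V 0 = 1)
    (h : ∀ r < n, V r * FreeGroup.mk (f r) = FreeGroup.mk (g r) * V (r + 1)) :
    FreeGroup.mk (wordOn f 0 n) = FreeGroup.mk (wordOn g 0 n) * V n := by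
  induction n with
  | zero => rw [wordOn_zero, wordOn_zero, h0, mul_one]
  | succ n ih =>
    rw [wordOn_succ, wordOn_succ, ← FreeGroup.mul_mk, ← FreeGroup.mul_mk,
      ih fun r hr => h r (by omega), mul_assoc, mul_assoc, zero_add, h n (by omega)]

namespace IsFlow

/-- Sweeping over a column does not change the product of the letters. -/
theorem mk_wordOn_column (hD : IsFlow k D) {c : ℕ} {A B : ℕ → Option (ℕ × ℕ)}
    (hnd : ∀ r ≤ 2 ^ k, [A r, some (r - 1, c), B r, some (r + 1, c)].Nodup)
    (hc : ∀ r ≤ 2 ^ k, ∀ i w, D i (some (r, c)) w ∨ D i w (some (r, c)) →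
      w ∈ [A r, some (r - 1, c), B r, some (r + 1, c)]) :
    FreeGroup.mk (wordOn (fun r => flowWord D (A r) (some (r, c))) 0 (2 ^ k + 1)) =
      FreeGroup.mk (wordOn (fun r => flowWord D (some (r, c)) (B r)) 0 (2 ^ k + 1)) := by
  -- `V r` is the letter of the vertical edge entering row `r` from above: the boundary between the
  -- swept and unswept parts of the column.
  have key := mk_wordOn_sweep (f := fun r => flowWord D (A r) (some (r, c)))
    (g := fun r => flowWord D (some (r, c)) (B r)) (n := 2 ^ k + 1)
    (V := fun r => FreeGroup.mk (flowWord D (some (r - 1, c)) (some (r, c)))) ?_ ?_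
  · rw [key, flowWord_eq_nil]
    · exact mul_one _
    · intro i hi
      have := (hD.adj hi).1
      simp at this
    · intro i hi
      have := (hD.adj hi).1
      simp at this
  -- In row `0` truncated subtraction turns the edge from above into a loop, which no path uses.
  · show FreeGroup.mk (flowWord D (some (0, c)) (some (0, c))) = 1
    rw [flowWord_eq_nil]
    · rfl
    · exact fun i hi => hD.not_swap hi hi
    · exact fun i hi => hD.not_swap hi hi
  · intro r hr
    -- The neighbours are listed in cyclic order left, up, right, down; solving the relation around
    -- the vertex gives the sweep step.
    have h := hD.prod_flowWord (hnd r (by omega)) (hc r (by omega))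
    simp only [List.map_cons, List.map_nil, List.prod_cons, List.prod_nil, mul_one] at h
    rw [hD.flowWord_swap (A r), hD.flowWord_swap (some (r - 1, c)), ← FreeGroup.inv_mk,
      ← FreeGroup.inv_mk] at h
    simp only [Nat.add_sub_cancel]
    rw [← mul_assoc, ← mul_inv_rev, inv_mul_eq_one] at h
    exact h

/-- A terminal of the left border has no additional edge there and every other row has exactly one,
so a single outer slot per row suffices. -/
theorem mk_wordOn_left (hD : IsFlow k D) :
    FreeGroup.mk (wordOn (fun r => flowWord D (leftSlot r) (some (r, 0))) 0 (2 ^ k + 1)) =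
      FreeGroup.mk (wordOn (fun r => flowWord D (some (r, 0)) (some (r, 0 + 1))) 0
        (2 ^ k + 1)) := by
  have hpos : 0 < 2 ^ k := by positivity
  refine hD.mk_wordOn_column ?_ ?_
  · intro r hr
    by_cases ht : IsLeftTerminal r
    · rw [leftSlot, if_pos ht]
      simp
    · obtain ⟨a, r', h, h1, h2, h3, h4⟩ := exists_leftSlot_eq_some ht
      rw [h]
      -- The rows joined by an additional edge have an even sum, so it never coincides with a
      -- vertical edge.
      simp; omega
  · intro r hr i w hw
    rcases w with _ | q
    · rw [hD.target, hD.source] at hw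
      have : leftSlot r = none := by
        rcases hw with ⟨_, hw⟩ | ⟨_, hw⟩
        · unfold targetPos at hw
          split_ifs at hw <;> rw [Prod.mk.injEq] at hw
          · rw [hw.1, leftSlot_zero]
          · omega
          · rw [hw.1, leftSlot_three]
        · rw [Prod.mk.injEq] at hw
          rw [hw.1, leftSlot_two_pow]
      simp [this]
    · have hadj : GridAdj k (r, 0) q := by
        rcases hw with hw | hw
        · exact hD.adj hw
        · exact (hD.adj hw).symm
      obtain ⟨q1, q2⟩ := q
      obtain ⟨_, ⟨h, h'⟩ | ⟨h, h'⟩ | ⟨h, h', hne, a, ha, h5, h6⟩ | ⟨h, h', hne, h5⟩⟩ := hadj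
      · simp at h h' ⊢; omega
      · simp at h h' ⊢; omega
      · simp only at h' ha h5 h6 hne
        rw [leftSlot_eq_some ha h5 h6 hne, h']
        simp
      · simp only at h; omega

theorem mk_wordOn_middle (hD : IsFlow k D) {c : ℕ} (hc : c + 1 < 2 ^ k) :
    FreeGroup.mk (wordOn (fun r => flowWord D (some (r, c)) (some (r, c + 1))) 0 (2 ^ k + 1)) =
      FreeGroup.mk (wordOn (fun r => flowWord D (some (r, c + 1)) (some (r, c + 1 + 1))) 0
        (2 ^ k + 1)) := by
  refine hD.mk_wordOn_column ?_ ?_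
  · intro r hr
    simp
    omega
  · intro r hr i w hw
    rcases w with _ | q
    · exfalso
      rw [hD.target, hD.source] at hw
      rcases hw with ⟨_, hw⟩ | ⟨_, hw⟩
      · unfold targetPos at hw
        split_ifs at hw <;> rw [Prod.mk.injEq] at hw <;> omega
      · rw [Prod.mk.injEq] at hw; omega
    · have hadj : GridAdj k (r, c + 1) q := by
        rcases hw with hw | hw
        · exact hD.adj hw
        · exact (hD.adj hw).symm
      obtain ⟨q1, q2⟩ := q
      obtain ⟨_, ⟨h, h'⟩ | ⟨h, h'⟩ | ⟨h, h', hne, a, ha, h5, h6⟩ | ⟨h, h', hne, h5⟩⟩ := hadj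
      · simp at h h' ⊢; omega
      · simp at h h' ⊢; omega
      · simp only at h; omega
      · simp only at h; omega

theorem mk_wordOn_right (hD : IsFlow k D) (hk : 1 ≤ k) {c : ℕ} (hc : c + 1 = 2 ^ k) :
    FreeGroup.mk (wordOn (fun r => flowWord D (some (r, c)) (some (r, c + 1))) 0 (2 ^ k + 1)) =
      FreeGroup.mk (wordOn (fun r => flowWord D (some (r, c + 1)) (rightSlot k r)) 0
        (2 ^ k + 1)) := by
  obtain ⟨k, rfl⟩ := Nat.exists_eq_add_of_le' hk
  have hpos : 0 < 2 ^ k := by positivity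
  have hpow : 2 ^ (k + 1) = 2 * 2 ^ k := by rw [pow_succ, mul_comm]
  refine hD.mk_wordOn_column ?_ ?_
  · intro r hr
    by_cases ht : 2 * r = 2 ^ (k + 1)
    · rw [rightSlot, if_pos ht]
      simp
    · rw [rightSlot, if_neg ht]
      simp; omega
  · intro r hr i w hw
    rcases w with _ | q
    · rw [hD.target, hD.source] at hw
      have : rightSlot (k + 1) r = none := by
        rcases hw with ⟨_, hw⟩ | ⟨_, hw⟩
        · unfold targetPos at hw
          split_ifs at hw with h1 h2 <;> rw [Prod.mk.injEq] at hw
          · omega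
          · obtain rfl : i = k := by omega
            exact if_pos (by omega)
          · omega
        · rw [Prod.mk.injEq] at hw
          omega
      simp [this]
    · have hadj : GridAdj (k + 1) (r, c + 1) q := by
        rcases hw with hw | hw
        · exact hD.adj hw
        · exact (hD.adj hw).symm
      obtain ⟨q1, q2⟩ := q
      obtain ⟨hb, ⟨h, h'⟩ | ⟨h, h'⟩ | ⟨h, h', hne, a, ha, h5, h6⟩ | ⟨h, h', hne, h5⟩⟩ := hadj
      · simp at h h' hb ⊢; omega
      · simp at h h' ⊢; omega
      · simp only at h; omega
      · simp only at h h' hne h5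
        have : rightSlot (k + 1) r = some (q1, q2) := by
          rw [rightSlot, if_neg (by omega), h']
          congr 2
          omega
        simp [this]

theorem isLeftWord (hD : IsFlow k D) :
    IsLeftWord k fun r => flowWord D (leftSlot r) (some (r, 0)) where
  length_le _ := length_flowWord_le _ _
  zero := by
    rw [leftSlot_zero]
    exact hD.flowWord_of_swap (hD.target.2 ⟨le_rfl, by simp [targetPos]⟩)
  two_pow a ha := by
    rw [leftSlot_two_pow]
    exact hD.flowWord_of (hD.source.2 ⟨ha, rfl⟩)
  three a ha := by
    rw [leftSlot_three]
    refine hD.flowWord_of_swap (hD.target.2 ⟨by omega, ?_⟩)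
    rw [targetPos, if_neg (by omega), if_neg (by omega)]
  reflect a m ha h1 h2 := by
    rw [leftSlot_eq_some (a := a) (r := 3 * 2 ^ a + m) (r' := 3 * 2 ^ a - m) (by omega) (by omega)
        (by omega) (by omega),
      leftSlot_eq_some (a := a) (r := 3 * 2 ^ a - m) (r' := 3 * 2 ^ a + m) (by omega) (by omega)
        (by omega) (by omega)]
    exact hD.flowWord_swap _ _

/-- Reflection in the middle row swaps the ends of each additional edge, so the lower half of the
word inverts the upper half; the middle letter is the end of the path of level `k - 1`. -/
theorem mk_wordOn_rightSlot (hD : IsFlow k D) (hk : 1 ≤ k) :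
    ∃ g, FreeGroup.mk (wordOn (fun r => flowWord D (some (r, 2 ^ k)) (rightSlot k r)) 0
      (2 ^ k + 1)) = g * FreeGroup.of (k - 1) * g⁻¹ := by
  obtain ⟨k, rfl⟩ := Nat.exists_eq_add_of_le' hk
  have hpos : 0 < 2 ^ k := by positivity
  have hpow : 2 ^ (k + 1) = 2 * 2 ^ k := by rw [pow_succ, mul_comm]
  have h1 : 2 ^ (k + 1) + 1 = 2 ^ k + (1 + 2 ^ k) := by omega
  refine ⟨FreeGroup.mk (wordOn (fun r => flowWord D (some (r, 2 ^ (k + 1)))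
    (rightSlot (k + 1) r)) 0 (2 ^ k)), ?_⟩
  · rw [h1, wordOn_add, wordOn_add, wordOn_one, zero_add,
      wordOn_reflect (c := 2 ^ k) (n := 2 ^ k) le_rfl, Nat.sub_self]
    · have h2 : rightSlot (k + 1) (2 ^ k) = none := if_pos hpow.symm
      rw [h2, hD.flowWord_of (hD.target.2 ⟨Nat.le_succ k, by simp [targetPos]⟩)]
      simp only [← FreeGroup.mul_mk, ← FreeGroup.inv_mk, mk_singleton_true, Nat.add_sub_cancel,
        ← mul_assoc]
    · intro m hm1 hm2
      rw [rightSlot, if_neg (by omega), rightSlot, if_neg (by omega), hD.flowWord_swap,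
        show 2 ^ (k + 1) - (2 ^ k + m) = 2 ^ k - m by omega,
        show 2 ^ (k + 1) - (2 ^ k - m) = 2 ^ k + m by omega]

theorem mk_wordOn_gap (hD : IsFlow k D) {c : ℕ} (hc : c < 2 ^ k) :
    FreeGroup.mk (wordOn (fun r => flowWord D (some (r, c)) (some (r, c + 1))) 0 (2 ^ k + 1)) =
      FreeGroup.mk (wordOn (fun r => flowWord D (leftSlot r) (some (r, 0))) 0 (2 ^ k + 1)) := by
  induction c with
  | zero => exact (hD.mk_wordOn_left).symm
  | succ c ih => rw [← hD.mk_wordOn_middle hc, ih (by omega)]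

theorem mk_wordOn_rightSlot_eq (hD : IsFlow k D) (hk : 1 ≤ k) :
    FreeGroup.mk (wordOn (fun r => flowWord D (some (r, 2 ^ k)) (rightSlot k r)) 0 (2 ^ k + 1)) =
      FreeGroup.mk (wordOn (fun r => flowWord D (leftSlot r) (some (r, 0))) 0 (2 ^ k + 1)) := by
  have hpos : 0 < 2 ^ k := by positivity
  have h := hD.mk_wordOn_right hk (c := 2 ^ k - 1) (by omega)
  rw [hD.mk_wordOn_gap (by omega), Nat.sub_add_cancel hpos] at h
  exact h.symm

theorem exists_conj (hD : IsFlow k D) (hk : 1 ≤ k) :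
    ∃ g, FreeGroup.mk (wordOn (fun r => flowWord D (leftSlot r) (some (r, 0))) 0 (2 ^ k + 1)) =
      g * FreeGroup.of (k - 1) * g⁻¹ := by
  rw [← hD.mk_wordOn_rightSlot_eq hk]
  exact hD.mk_wordOn_rightSlot hk

theorem flowWord_left (hD : IsFlow k D) (hk : 1 ≤ k) {r : ℕ} (hr : r ≤ 2 ^ k) :
    flowWord D (leftSlot r) (some (r, 0)) = [rowLetter k r] :=
  hD.isLeftWord.eq_rowLetter hk (hD.exists_conj hk) (by omega)

theorem flowWord_gap (hD : IsFlow k D) (hk : 1 ≤ k) {r c : ℕ} (hr : r ≤ 2 ^ k) (hc : c < 2 ^ k) :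
    flowWord D (some (r, c)) (some (r, c + 1)) = [rowLetter k r] :=
  hD.isLeftWord.eq_rowLetter_of_mk_eq hk (hD.exists_conj hk)
    (f := fun r => flowWord D (some (r, c)) (some (r, c + 1)))
    (fun _ => length_flowWord_le _ _) (hD.mk_wordOn_gap hc) (by omega)

theorem flowWord_right (hD : IsFlow k D) (hk : 1 ≤ k) {r : ℕ} (hr : r ≤ 2 ^ k) :
    flowWord D (some (r, 2 ^ k)) (rightSlot k r) = [rowLetter k r] :=
  hD.isLeftWord.eq_rowLetter_of_mk_eq hk (hD.exists_conj hk)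
    (f := fun r => flowWord D (some (r, 2 ^ k)) (rightSlot k r))
    (fun _ => length_flowWord_le _ _) (hD.mk_wordOn_rightSlot_eq hk) (by omega)

end IsFlow

end Flow

/-- The successor of a vertex on the paths of the solution. -/
noncomputable def nextPos (k : ℕ) (p : ℕ × ℕ) : Option (ℕ × ℕ) :=
  if (rowLetter k p.1).2 then (if p.2 < 2 ^ k then some (p.1, p.2 + 1) else rightSlot k p.1)
  else (if 0 < p.2 then some (p.1, p.2 - 1) else leftSlot p.1)

/-- A flow follows the successor function at every vertex of the grid. -/
theorem IsFlow.nextPos {k : ℕ} {D : ℕ → Option (ℕ × ℕ) → Option (ℕ × ℕ) → Prop}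
    (hD : IsFlow k D) (hk : 1 ≤ k) {p : ℕ × ℕ} (h1 : p.1 ≤ 2 ^ k) (h2 : p.2 ≤ 2 ^ k) :
    D (rowLetter k p.1).1 (some p) (nextPos k p) := by
  obtain ⟨r, c⟩ := p
  simp only at h1 h2
  unfold _root_.nextPos
  rcases hs : rowLetter k r with ⟨a, _ | _⟩
  · simp only [Bool.false_eq_true, if_false]
    split_ifs with hc
    · obtain ⟨c, rfl⟩ := Nat.exists_eq_add_of_lt hc
      simp only [zero_add, Nat.add_sub_cancel] at h2 ⊢
      exact of_flowWord_false ((hD.flowWord_gap hk h1 (by omega)).trans (by rw [hs]))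
    · obtain rfl : c = 0 := by omega
      exact of_flowWord_false ((hD.flowWord_left hk h1).trans (by rw [hs]))
  · simp only [if_true]
    split_ifs with hc
    · exact of_flowWord_true ((hD.flowWord_gap hk h1 hc).trans (by rw [hs]))
    · obtain rfl : c = 2 ^ k := by omega
      exact of_flowWord_true ((hD.flowWord_right hk h1).trans (by rw [hs]))

/-! ### Steps of paths, and walks along a successor function. -/

section Walks

variable {V : Type*} {G : SimpleGraph V}

/-- The step relation of a walk, with a virtual vertex `none` before its start and after its
end. -/
def SimpleGraph.Walk.Step {u v : V} (w : G.Walk u v) : Option V → Option V → Prop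
  | none, none => False
  | none, some x => x = u
  | some x, none => x = v
  | some x, some y => ∃ d ∈ w.darts, d.fst = x ∧ d.snd = y

namespace SimpleGraph.Walk

variable {u v : V} {w : G.Walk u v}

theorem Step.snd_mem {a : Option V} {x : V} (h : w.Step a (some x)) : x ∈ w.support := by
  rcases a with _ | a
  · obtain rfl : x = u := h
    exact w.start_mem_support
  · obtain ⟨d, hd, _, rfl⟩ := h
    exact w.dart_snd_mem_support_of_mem_darts hd

theorem Step.fst_mem {b : Option V} {x : V} (h : w.Step (some x) b) : x ∈ w.support := by
  rcases b with _ | b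
  · obtain rfl : x = v := h
    exact w.end_mem_support
  · obtain ⟨d, hd, rfl, _⟩ := h
    exact w.dart_fst_mem_support_of_mem_darts hd

theorem exists_step_in {x : V} (h : x ∈ w.support) : ∃ a, w.Step a (some x) := by
  rw [← cons_map_snd_darts, List.mem_cons, List.mem_map] at h
  rcases h with rfl | ⟨d, hd, rfl⟩
  · exact ⟨none, rfl⟩
  · exact ⟨some d.fst, d, hd, rfl, rfl⟩

theorem exists_step_out {x : V} (h : x ∈ w.support) : ∃ b, w.Step (some x) b := by
  rw [← map_fst_darts_append, List.mem_append, List.mem_map, List.mem_singleton] at h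
  rcases h with ⟨d, hd, rfl⟩ | rfl
  · exact ⟨some d.snd, d, hd, rfl, rfl⟩
  · exact ⟨none, rfl⟩

theorem IsPath.dart_ext_fst (hw : w.IsPath) {d d' : G.Dart} (hd : d ∈ w.darts)
    (hd' : d' ∈ w.darts) (h : d.fst = d'.fst) : d = d' := by
  have hn := hw.support_nodup
  rw [← map_fst_darts_append, List.nodup_append] at hn
  exact List.inj_on_of_nodup_map hn.1 hd hd' h

theorem IsPath.dart_ext_snd (hw : w.IsPath) {d d' : G.Dart} (hd : d ∈ w.darts)
    (hd' : d' ∈ w.darts) (h : d.snd = d'.snd) : d = d' := by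
  have hn := hw.support_nodup
  rw [← cons_map_snd_darts, List.nodup_cons] at hn
  exact List.inj_on_of_nodup_map hn.2 hd hd' h

theorem IsPath.dart_fst_ne (hw : w.IsPath) {d : G.Dart} (hd : d ∈ w.darts) : d.fst ≠ v := by
  have hn := hw.support_nodup
  rw [← map_fst_darts_append, List.nodup_append] at hn
  exact hn.2.2 _ (List.mem_map_of_mem hd) _ (List.mem_singleton_self _)

theorem IsPath.dart_snd_ne (hw : w.IsPath) {d : G.Dart} (hd : d ∈ w.darts) : d.snd ≠ u := by
  have hn := hw.support_nodup
  rw [← cons_map_snd_darts, List.nodup_cons] at hn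
  intro h
  have h1 : d.snd ∈ w.darts.map (·.snd) := List.mem_map_of_mem hd
  exact hn.1 (h ▸ h1)

theorem IsPath.step_in_unique (hw : w.IsPath) {a a' : Option V} {x : V}
    (h : w.Step a (some x)) (h' : w.Step a' (some x)) : a = a' := by
  rcases a with _ | a <;> rcases a' with _ | a'
  · rfl
  · obtain ⟨d, hd, _, h2⟩ := h'
    exact absurd (h2.trans h) (hw.dart_snd_ne hd)
  · obtain ⟨d, hd, _, h2⟩ := h
    exact absurd (h2.trans h') (hw.dart_snd_ne hd)
  · obtain ⟨d, hd, rfl, h2⟩ := h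
    obtain ⟨d', hd', rfl, h2'⟩ := h'
    rw [hw.dart_ext_snd hd hd' (h2.trans h2'.symm)]

theorem IsPath.step_out_unique (hw : w.IsPath) {b b' : Option V} {x : V}
    (h : w.Step (some x) b) (h' : w.Step (some x) b') : b = b' := by
  rcases b with _ | b <;> rcases b' with _ | b'
  · rfl
  · obtain ⟨d, hd, h2, _⟩ := h'
    exact absurd (h2.trans h) (hw.dart_fst_ne hd)
  · obtain ⟨d, hd, h2, _⟩ := h
    exact absurd (h2.trans h') (hw.dart_fst_ne hd)
  · obtain ⟨d, hd, h2, rfl⟩ := h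
    obtain ⟨d', hd', h2', rfl⟩ := h'
    rw [hw.dart_ext_fst hd hd' (h2.trans h2'.symm)]

/-- Distinct ends are needed because `none` stands both before the start and after the end. -/
theorem IsPath.not_step_swap (hw : w.IsPath) (huv : u ≠ v) {a b : Option V} (h : w.Step a b) :
    ¬ w.Step b a := by
  intro h'
  rcases a with _ | a <;> rcases b with _ | b
  · exact h
  · exact huv (Eq.trans (Eq.symm h) h')
  · exact huv (Eq.trans (Eq.symm h') h)
  · obtain ⟨d, hd, h1, h2⟩ := h
    obtain ⟨d', hd', h1', h2'⟩ := h'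
    have hn := hw.isTrail.edges_nodup
    rw [edges_eq_map_darts] at hn
    have he : d'.edge = d.edge :=
      (SimpleGraph.dart_edge_eq_iff d' d).2 (Or.inr (by
        ext
        · exact h1'.trans h2.symm
        · exact h2'.trans h1.symm))
    have := List.inj_on_of_nodup_map hn hd' hd he
    subst this
    exact d'.adj.ne (h1.trans h2'.symm)

/-- Two paths with the same ends that follow the same successor function are equal. -/
theorem IsPath.eq_of_forall_dart {α : Type*} {f : V → α} {c : V → α} (hc : Function.Injective c)
    {u v : V} {p q : G.Walk u v} (hp : p.IsPath) (hq : q.IsPath)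
    (hpf : ∀ d ∈ p.darts, f d.fst = c d.snd) (hqf : ∀ d ∈ q.darts, f d.fst = c d.snd) :
    p = q := by
  induction p with
  | nil => exact (isPath_iff_nil.1 hq).eq_nil.symm
  | cons h p ih =>
    cases q with
    | nil => exact absurd p.end_mem_support ((cons_isPath_iff _ _).1 hp).2
    | cons h' q =>
      have h1 := hpf _ (by rw [darts_cons]; exact List.mem_cons_self)
      have h2 := hqf _ (by rw [darts_cons]; exact List.mem_cons_self)
      obtain rfl := hc (h1.symm.trans h2)
      rw [ih ((cons_isPath_iff _ _).1 hp).1 ((cons_isPath_iff _ _).1 hq).1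
        (fun d hd => hpf d (by rw [darts_cons]; exact List.mem_cons_of_mem _ hd))
        (fun d hd => hqf d (by rw [darts_cons]; exact List.mem_cons_of_mem _ hd))]

end SimpleGraph.Walk

/-- Following an injective partial successor function from a vertex that is not a successor, one
arrives at a vertex without successor. -/
theorem exists_walk_of_successor [Finite V] {f : V → Option V} {A : V → Prop} {s t : V}
    (hinj : ∀ x y z, f x = some z → f y = some z → x = y) (hs : ∀ x, f x ≠ some s)
    (hadj : ∀ x y, f x = some y → G.Adj x y) (hA : A s)
    (hfA : ∀ x y, A x → f x = some y → A y) (ht : ∀ x, A x → f x = none → x = t) :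
    ∃ w : G.Walk s t, ∀ x ∈ w.support, A x := by
  let g : ℕ → Option V := fun n => n.rec (some s) fun _ o => o.bind f
  have g0 : g 0 = some s := rfl
  have gs : ∀ n, g (n + 1) = (g n).bind f := fun _ => rfl
  have hwalk : ∀ n x, g n = some x → ∃ w : G.Walk s x, ∀ y ∈ w.support, A y := by
    intro n
    induction n with
    | zero =>
      intro x hx
      obtain rfl : s = x := Option.some.inj hx
      exact ⟨.nil, fun y hy => by
        rw [SimpleGraph.Walk.support_nil, List.mem_singleton] at hy; rwa [hy]⟩
    | succ n ih =>
      intro x hx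
      rw [gs, Option.bind_eq_some_iff] at hx
      obtain ⟨y, hy, hyx⟩ := hx
      obtain ⟨w, hw⟩ := ih y hy
      refine ⟨w.concat (hadj y x hyx), fun z hz => ?_⟩
      rw [SimpleGraph.Walk.support_concat, List.mem_append, List.mem_singleton] at hz
      rcases hz with hz | rfl
      · exact hw z hz
      · exact hfA y z (hw y w.end_mem_support) hyx
  have hnone : ∃ n, g n = none := by
    by_contra! hne
    have hne' : ∀ n, ∃ x, g n = some x := fun n => Option.ne_none_iff_exists'.1 (hne n)
    -- By injectivity a repetition can be pulled back to the start, which is not a successor.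
    have hlt : ∀ m n, g m ≠ g (m + n + 1) := by
      intro m
      induction m with
      | zero =>
        intro n h
        rw [g0, gs] at h
        obtain ⟨x, _, hx⟩ := Option.bind_eq_some_iff.1 h.symm
        exact hs x hx
      | succ m ih =>
        intro n h
        obtain ⟨z, hz⟩ := hne' (m + 1)
        have hz' := h ▸ hz
        rw [gs] at hz
        rw [gs] at hz'
        obtain ⟨x, hx, hxz⟩ := Option.bind_eq_some_iff.1 hz
        obtain ⟨y, hy, hyz⟩ := Option.bind_eq_some_iff.1 hz'
        obtain rfl := hinj x y z hxz hyz
        apply ih n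
        rw [hx, ← hy, show m + 1 + n = m + n + 1 by omega]
    choose c hc using hne'
    refine not_injective_infinite_finite c fun m n hmn => ?_
    by_contra hne''
    have hg : g m = g n := by rw [hc, hc, hmn]
    rcases Nat.lt_or_gt_of_ne hne'' with h | h
    · obtain ⟨d, rfl⟩ := Nat.exists_eq_add_of_lt h
      exact hlt _ _ hg
    · obtain ⟨d, rfl⟩ := Nat.exists_eq_add_of_lt h
      exact hlt _ _ hg.symm
  have hlast : ∀ n, g n = none → ∃ m x, g m = some x ∧ g (m + 1) = none := by
    intro n
    induction n with
    | zero => exact fun h => absurd (g0.symm.trans h) (by simp)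
    | succ n ih =>
      intro h
      rcases hx : g n with _ | x
      · exact ih hx
      · exact ⟨n, x, hx, h⟩
  obtain ⟨n, hn⟩ := hnone
  obtain ⟨m, x, hx, h1⟩ := hlast n hn
  obtain ⟨w, hw⟩ := hwalk m x hx
  rw [gs, hx, Option.bind_some] at h1
  obtain rfl := ht x (hw x w.end_mem_support) h1
  exact ⟨w, hw⟩

/-! ### The crossing number as the number of entries into the inner part. -/

open Classical in
/-- The number of darts of a walk that enter a set of vertices. -/
noncomputable def enterCount (I : Set V) {u v : V} (w : G.Walk u v) : ℕ :=
  w.darts.countP fun d => d.fst ∉ I ∧ d.snd ∈ I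

theorem enterCount_cons_of_enter {I : Set V} {u v x : V} (h : G.Adj u v) (w : G.Walk v x)
    (hu : u ∉ I) (hv : v ∈ I) : enterCount I (w.cons h) = enterCount I w + 1 := by
  classical
  unfold enterCount
  rw [SimpleGraph.Walk.darts_cons, List.countP_cons_of_pos]
  exact decide_eq_true ⟨hu, hv⟩

theorem enterCount_cons_of_not {I : Set V} {u v x : V} (h : G.Adj u v) (w : G.Walk v x)
    (huv : ¬ (u ∉ I ∧ v ∈ I)) : enterCount I (w.cons h) = enterCount I w := by
  classical
  unfold enterCount
  rw [SimpleGraph.Walk.darts_cons, List.countP_cons_of_neg]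
  simpa using huv

theorem enterCount_append (I : Set V) {u v x : V} (w : G.Walk u v) (w' : G.Walk v x) :
    enterCount I (w.append w') = enterCount I w + enterCount I w' := by
  classical
  unfold enterCount
  rw [SimpleGraph.Walk.darts_append, List.countP_append]

theorem one_le_enterCount {I : Set V} {u v : V} {w : G.Walk u v} (hu : u ∉ I)
    (h : ∃ x ∈ w.support, x ∈ I) : 1 ≤ enterCount I w := by
  induction w with
  | nil =>
    obtain ⟨x, hx, hxI⟩ := h
    rw [SimpleGraph.Walk.support_nil, List.mem_singleton] at hx
    exact absurd (hx ▸ hxI) hu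
  | @cons u v x e p ih =>
    by_cases hv : v ∈ I
    · rw [enterCount_cons_of_enter e p hu hv]
      omega
    · rw [enterCount_cons_of_not e p fun h' => hv h'.2]
      obtain ⟨y, hy, hyI⟩ := h
      rw [SimpleGraph.Walk.support_cons, List.mem_cons] at hy
      exact ih hv ⟨y, hy.resolve_left fun h' => hu (h' ▸ hyI), hyI⟩

theorem CrossesTimes.le_enterCount {I : Set V} {m : ℕ} {u v : V} {w : G.Walk u v}
    (h : CrossesTimes I m w) : m ≤ enterCount I w := by
  induction h with
  | one w hw => exact one_le_enterCount hw.1 hw.2.2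
  | append w w' hw _ ih =>
    have := one_le_enterCount hw.1 hw.2.2
    rw [enterCount_append]
    omega

theorem CrossesTimes.cons {I : Set V} {m : ℕ} {u v x : V} {w : G.Walk v x}
    (h : CrossesTimes I m w) (e : G.Adj u v) (hu : u ∉ I) : CrossesTimes I m (w.cons e) := by
  have hcross : ∀ {v x : V} {w : G.Walk v x} (e : G.Adj u v), Crosses I w →
      Crosses I (w.cons e) := by
    rintro v x w e ⟨_, h2, y, hy, hyI⟩
    exact ⟨hu, h2, y, by rw [SimpleGraph.Walk.support_cons]; exact List.mem_cons_of_mem _ hy, hyI⟩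
  cases h with
  | one w hw => exact .one _ (hcross e hw)
  | append w w' hw hw' =>
    rw [← SimpleGraph.Walk.cons_append]
    exact .append _ _ (hcross e hw) hw'

/-- A walk that ends outside of `I` can be split into as many crossing walks as it enters `I`; a
walk that starts in `I` is completed by one that leads there from outside. -/
theorem crossesTimes_enterCount {I : Set V} {u v : V} (w : G.Walk u v) (hv : v ∉ I) :
    (u ∉ I → enterCount I w = 0 ∨ CrossesTimes I (enterCount I w) w) ∧
      (∀ {x : V} (p : G.Walk x u), x ∉ I → (∃ y ∈ p.support, y ∈ I) →
        CrossesTimes I (enterCount I w + 1) (p.append w)) := by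
  induction w with
  | nil =>
    refine ⟨fun _ => Or.inl rfl, fun p hx hp => ?_⟩
    rw [SimpleGraph.Walk.append_nil]
    exact .one _ ⟨hx, hv, hp⟩
  | @cons u u' v e w ih =>
    obtain ⟨ih1, ih2⟩ := ih hv
    have first : u ∉ I → enterCount I (w.cons e) = 0 ∨
        CrossesTimes I (enterCount I (w.cons e)) (w.cons e) := by
      intro hu
      by_cases hu' : u' ∈ I
      · right
        rw [enterCount_cons_of_enter e w hu hu']
        -- The entering edge serves as the prefix that has already visited `I`; it accounts for the
        -- extra `1`.
        exact ih2 (SimpleGraph.Walk.cons e .nil) hu ⟨u', by simp, hu'⟩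
      · rw [enterCount_cons_of_not e w fun h => hu' h.2]
        exact (ih1 hu').imp_right fun h => h.cons e hu
    refine ⟨first, fun p hx hp => ?_⟩
    -- The walk is cut just before a new entry; any other edge is absorbed into the prefix.
    by_cases hent : u ∉ I ∧ u' ∈ I
    · rcases first hent.1 with h | h
      · rw [enterCount_cons_of_enter e w hent.1 hent.2] at h
        omega
      · exact .append _ _ ⟨hx, hent.1, hp⟩ h
    · rw [enterCount_cons_of_not e w hent, ← SimpleGraph.Walk.concat_append]
      obtain ⟨y, hy, hyI⟩ := hp
      exact ih2 _ hx ⟨y, by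
        rw [SimpleGraph.Walk.support_concat]
        exact List.mem_append_left _ hy, hyI⟩

theorem crossingNumber_eq_enterCount {I : Set V} {u v : V} (w : G.Walk u v) (hu : u ∉ I)
    (hv : v ∉ I) : crossingNumber I w = enterCount I w := by
  obtain ⟨h1, h2⟩ := crossingNumber_isGreatest I w
  apply le_antisymm
  · rcases h1 with h | h
    · rw [h]; exact Nat.zero_le _
    · exact h.le_enterCount
  · exact h2 ((crossesTimes_enterCount w hv).1 hu)

end Walks

/-! ### The instance in coordinates. -/

/-- The row and the column of a vertex. -/
def coord {k : ℕ} (v : InstVertex k) : ℕ × ℕ := (v.1.val, v.2.val)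

theorem coord_injective (k : ℕ) : Function.Injective (coord (k := k)) := by
  rintro ⟨a, b⟩ ⟨c, d⟩ h
  rw [coord, coord, Prod.mk.injEq] at h
  exact Prod.ext (Fin.ext h.1) (Fin.ext h.2)

theorem coord_fst_le {k : ℕ} (v : InstVertex k) : (coord v).1 ≤ 2 ^ k := by
  have := v.1.isLt
  unfold coord
  omega

theorem coord_snd_le {k : ℕ} (v : InstVertex k) : (coord v).2 ≤ 2 ^ k := by
  have := v.2.isLt
  unfold coord
  omega

theorem exists_coord_eq {k : ℕ} {p : ℕ × ℕ} (h1 : p.1 ≤ 2 ^ k) (h2 : p.2 ≤ 2 ^ k) :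
    ∃ v : InstVertex k, coord v = p :=
  ⟨(⟨p.1, by omega⟩, ⟨p.2, by omega⟩), rfl⟩

theorem coord_termS (k : ℕ) (i : Fin (k + 1)) : coord (termS k i) = (2 ^ (k - i.val), 0) := rfl

theorem coord_termT (k : ℕ) (i : Fin (k + 1)) :
    coord (termT k i) = targetPos k (k - i.val) := by
  have hi := i.isLt
  unfold termT targetPos
  split_ifs <;> first
    | omega
    | rfl
    | rw [show k - i.val = k - 1 by omega]; rfl

theorem termS_ne_termT (k : ℕ) (i : Fin (k + 1)) : termS k i ≠ termT k i := by
  intro h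
  have h1 := congrArg coord h
  rw [coord_termS, coord_termT] at h1
  unfold targetPos at h1
  have hp : 0 < 2 ^ (k - i.val) := by positivity
  have hp' : 0 < 2 ^ k := by positivity
  split_ifs at h1 <;> rw [Prod.mk.injEq] at h1 <;> omega

theorem leftDetour_iff {k : ℕ} (p q : InstVertex k) :
    LeftDetour k p q ↔ (coord p).2 = 0 ∧ (coord q).2 = 0 ∧ (coord p).1 < (coord q).1 ∧
      ∃ a, (coord p).1 + (coord q).1 = 6 * 2 ^ a ∧ 2 * 2 ^ a < (coord p).1 := by
  unfold LeftDetour coord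
  have hq := q.1.isLt
  constructor
  · rintro ⟨i, m, h1, h2, h3, h4, h5, h6, h7, h8⟩
    rw [h5, h6]
    exact ⟨rfl, rfl, by omega, k - i, by omega, by omega⟩
  · rintro ⟨h1, h2, h3, a, h4, h5⟩
    -- Both rows lie in the grid, which forces `a + 1 < k`; so `i = k - a` is at least `2`.
    have h6 : 2 ^ (a + 1) < 2 ^ k := by rw [pow_succ]; omega
    rw [two_pow_lt_two_pow_iff] at h6
    refine ⟨k - a, q.1.val - 3 * 2 ^ a, by omega, by omega, by omega, ?_, Fin.ext h1,
      Fin.ext h2, ?_⟩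
    · rw [show k - (k - a) = a by omega]; omega
    · rw [show k - (k - a) = a by omega]; omega

theorem rightDetour_iff {k : ℕ} (hk : 1 ≤ k) (p q : InstVertex k) :
    RightDetour k p q ↔ (coord p).2 = 2 ^ k ∧ (coord q).2 = 2 ^ k ∧ (coord p).1 < (coord q).1 ∧
      (coord p).1 + (coord q).1 = 2 ^ k := by
  obtain ⟨k, rfl⟩ := Nat.exists_eq_add_of_le' hk
  have hpow : 2 ^ (k + 1) = 2 * 2 ^ k := by rw [pow_succ, mul_comm]
  unfold RightDetour coord
  rw [Nat.add_sub_cancel]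
  constructor
  · rintro ⟨m, h1, h2, h3, h4, h5, h6⟩
    rw [h3, h4]
    exact ⟨rfl, rfl, by omega, by omega⟩
  · rintro ⟨h1, h2, h3, h4⟩
    exact ⟨q.1.val - 2 ^ k, by omega, by omega, Fin.ext h1, Fin.ext h2, by omega, by omega⟩

theorem instGraph_adj_iff {k : ℕ} (hk : 1 ≤ k) (u v : InstVertex k) :
    (instGraph k).Adj u v ↔ GridAdj k (coord u) (coord v) := by
  have hne : u ≠ v ↔ coord u ≠ coord v := (coord_injective k).ne_iff.symm
  rw [instGraph, SimpleGraph.sup_adj, SimpleGraph.fromRel_adj, leftDetour_iff, leftDetour_iff,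
    rightDetour_iff hk, rightDetour_iff hk, gridGraph, SimpleGraph.boxProd_adj,
    SimpleGraph.pathGraph_adj, SimpleGraph.pathGraph_adj, hne, GridAdj]
  have e1 : (u.1 = v.1) ↔ (coord u).1 = (coord v).1 := Fin.ext_iff
  have e2 : (u.2 = v.2) ↔ (coord u).2 = (coord v).2 := Fin.ext_iff
  rw [e1, e2]
  have b1 := coord_fst_le u
  have b2 := coord_fst_le v
  have b3 := coord_snd_le u
  have b4 := coord_snd_le v
  change ((((coord u).1 + 1 = (coord v).1 ∨ (coord v).1 + 1 = (coord u).1) ∧ _) ∨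
    (((coord u).2 + 1 = (coord v).2 ∨ (coord v).2 + 1 = (coord u).2) ∧ _)) ∨ _ ↔ _
  generalize coord u = p at *
  generalize coord v = q at *
  obtain ⟨p1, p2⟩ := p
  obtain ⟨q1, q2⟩ := q
  simp only at *
  constructor
  · rintro ((⟨h1, h2⟩ | ⟨h1, h2⟩) | ⟨_, (⟨h1, h2, h3, a, h4, h5⟩ | ⟨h1, h2, h3, h4⟩) |
      (⟨h1, h2, h3, a, h4, h5⟩ | ⟨h1, h2, h3, h4⟩)⟩)
    · exact ⟨⟨b1, b3, b2, b4⟩, Or.inr (Or.inl ⟨h2, h1⟩)⟩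
    · exact ⟨⟨b1, b3, b2, b4⟩, Or.inl ⟨h2, h1⟩⟩
    · exact ⟨⟨b1, b3, b2, b4⟩, Or.inr (Or.inr (Or.inl ⟨h1, h2, by omega, a, h4, h5, by omega⟩))⟩
    · exact ⟨⟨b1, b3, b2, b4⟩, Or.inr (Or.inr (Or.inr ⟨h1, h2, by omega, h4⟩))⟩
    · exact ⟨⟨b1, b3, b2, b4⟩,
        Or.inr (Or.inr (Or.inl ⟨h2, h1, by omega, a, by omega, by omega, h5⟩))⟩
    · exact ⟨⟨b1, b3, b2, b4⟩, Or.inr (Or.inr (Or.inr ⟨h2, h1, by omega, by omega⟩))⟩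
  · rintro ⟨-, ⟨h1, h2⟩ | ⟨h1, h2⟩ | ⟨h1, h2, h3, a, h4, h5, h6⟩ | ⟨h1, h2, h3, h4⟩⟩
    · exact Or.inl (Or.inr ⟨h2, h1⟩)
    · exact Or.inl (Or.inl ⟨h2, h1⟩)
    · refine Or.inr ⟨by simp [h3], ?_⟩
      rcases Nat.lt_or_gt_of_ne h3 with h | h
      · exact Or.inl (Or.inl ⟨h1, h2, h, a, h4, h5⟩)
      · exact Or.inr (Or.inl ⟨h2, h1, h, a, by omega, h6⟩)
    · refine Or.inr ⟨by simp [h3], ?_⟩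
      rcases Nat.lt_or_gt_of_ne h3 with h | h
      · exact Or.inl (Or.inr ⟨h1, h2, h, h4⟩)
      · exact Or.inr (Or.inr ⟨h2, h1, h, by omega⟩)

/-! ### A solution is a flow; uniqueness. -/

section Solution

variable {k : ℕ}

/-- The flow of a family of paths between the terminals. -/
def solutionFlow (Q : ∀ i : Fin (k + 1), (instGraph k).Path (termS k i) (termT k i)) (a : ℕ)
    (u v : Option (ℕ × ℕ)) : Prop :=
  ∃ i : Fin (k + 1), k - i.val = a ∧ ∃ x y : Option (InstVertex k),
    x.map coord = u ∧ y.map coord = v ∧ (Q i).1.Step x y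

variable {Q : ∀ i : Fin (k + 1), (instGraph k).Path (termS k i) (termT k i)}

theorem IsDisjointPathsSolution.index_unique (hQ : IsDisjointPathsSolution Q)
    {i j : Fin (k + 1)} {x : InstVertex k} (hi : x ∈ (Q i).1.support)
    (hj : x ∈ (Q j).1.support) : i = j := by
  by_contra h
  exact hQ h hi hj

theorem map_coord_eq_some {x : Option (InstVertex k)} {p : ℕ × ℕ} (h : x.map coord = some p) :
    ∃ v, x = some v ∧ coord v = p := by
  simpa using h

theorem IsDisjointPathsSolution.isFlow (hk : 1 ≤ k) (hQ : IsDisjointPathsSolution Q) :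
    IsFlow k (solutionFlow Q) where
  in_unique := by
    rintro i j u u' p ⟨i, rfl, x, y, rfl, hy, h⟩ ⟨j, rfl, x', y', rfl, hy', h'⟩
    obtain ⟨v, rfl, hv⟩ := map_coord_eq_some hy
    obtain ⟨v', rfl, hv'⟩ := map_coord_eq_some hy'
    obtain rfl := coord_injective k (hv.trans hv'.symm)
    obtain rfl := hQ.index_unique h.snd_mem h'.snd_mem
    rw [(Q i).2.step_in_unique h h']
    exact ⟨rfl, rfl⟩
  out_unique := by
    rintro i j p w w' ⟨i, rfl, x, y, hx, rfl, h⟩ ⟨j, rfl, x', y', hx', rfl, h'⟩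
    obtain ⟨v, rfl, hv⟩ := map_coord_eq_some hx
    obtain ⟨v', rfl, hv'⟩ := map_coord_eq_some hx'
    obtain rfl := coord_injective k (hv.trans hv'.symm)
    obtain rfl := hQ.index_unique h.fst_mem h'.fst_mem
    rw [(Q i).2.step_out_unique h h']
    exact ⟨rfl, rfl⟩
  exists_out := by
    rintro i u p ⟨i, rfl, x, y, rfl, hy, h⟩
    obtain ⟨v, rfl, rfl⟩ := map_coord_eq_some hy
    obtain ⟨b, hb⟩ := SimpleGraph.Walk.exists_step_out h.snd_mem
    exact ⟨_, i, rfl, _, b, rfl, rfl, hb⟩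
  exists_in := by
    rintro i p w ⟨i, rfl, x, y, hx, rfl, h⟩
    obtain ⟨v, rfl, rfl⟩ := map_coord_eq_some hx
    obtain ⟨b, hb⟩ := SimpleGraph.Walk.exists_step_in h.fst_mem
    exact ⟨_, i, rfl, b, _, rfl, rfl, hb⟩
  not_swap := by
    rintro i j u v ⟨i, rfl, x, y, rfl, rfl, h⟩ ⟨j, rfl, y', x', hy, hx, h'⟩
    have hinj := Option.map_injective (coord_injective k)
    obtain rfl := hinj hx
    obtain rfl := hinj hy
    -- At least one end of the step is a real vertex, and it lies on both paths.
    have hij : i = j := by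
      rcases x' with _ | x
      · rcases y' with _ | y
        · exact h.elim
        · exact hQ.index_unique h.snd_mem h'.fst_mem
      · exact hQ.index_unique h.fst_mem h'.snd_mem
    subst hij
    exact (Q i).2.not_step_swap (termS_ne_termT k i) h h'
  source := by
    rintro a p
    constructor
    · rintro ⟨i, rfl, x, y, hx, hy, h⟩
      obtain ⟨v, rfl, rfl⟩ := map_coord_eq_some hy
      rw [Option.map_eq_none_iff] at hx
      subst hx
      obtain rfl : v = termS k i := h
      exact ⟨Nat.sub_le _ _, coord_termS k i⟩
    · rintro ⟨ha, rfl⟩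
      refine ⟨⟨k - a, by omega⟩, Nat.sub_sub_self ha, none, some _, rfl, ?_, rfl⟩
      rw [Option.map_some, coord_termS, Nat.sub_sub_self ha]
  target := by
    rintro a p
    constructor
    · rintro ⟨i, rfl, x, y, hx, hy, h⟩
      obtain ⟨v, rfl, rfl⟩ := map_coord_eq_some hx
      rw [Option.map_eq_none_iff] at hy
      subst hy
      obtain rfl : v = termT k i := h
      exact ⟨Nat.sub_le _ _, coord_termT k i⟩
    · rintro ⟨ha, rfl⟩
      refine ⟨⟨k - a, by omega⟩, Nat.sub_sub_self ha, some _, none, ?_, rfl, rfl⟩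
      rw [Option.map_some, coord_termT, Nat.sub_sub_self ha]
  adj := by
    rintro i p q ⟨i, rfl, x, y, hx, hy, h⟩
    obtain ⟨u, rfl, rfl⟩ := map_coord_eq_some hx
    obtain ⟨v, rfl, rfl⟩ := map_coord_eq_some hy
    obtain ⟨d, _, rfl, rfl⟩ := h
    exact (instGraph_adj_iff hk _ _).1 d.adj

/-- Every vertex lies on the path whose level is that of its row, and is followed there by its
successor. -/
theorem IsDisjointPathsSolution.exists_step (hk : 1 ≤ k) (hQ : IsDisjointPathsSolution Q)
    (v : InstVertex k) :
    ∃ i : Fin (k + 1), k - i.val = (rowLetter k (coord v).1).1 ∧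
      ∃ y : Option (InstVertex k), y.map coord = nextPos k (coord v) ∧
        (Q i).1.Step (some v) y := by
  obtain ⟨i, hi, x, y, hx, hy, h⟩ :=
    (hQ.isFlow hk).nextPos hk (coord_fst_le v) (coord_snd_le v)
  obtain ⟨u, rfl, hu⟩ := map_coord_eq_some hx
  obtain rfl := coord_injective k hu
  exact ⟨i, hi, y, hy, h⟩

theorem IsDisjointPathsSolution.level_eq (hk : 1 ≤ k) (hQ : IsDisjointPathsSolution Q)
    {i : Fin (k + 1)} {v : InstVertex k} (hv : v ∈ (Q i).1.support) :
    (rowLetter k (coord v).1).1 = k - i.val := by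
  obtain ⟨j, hj, y, _, h⟩ := hQ.exists_step hk v
  rw [← hj, hQ.index_unique hv h.fst_mem]

theorem IsDisjointPathsSolution.step_of_nextPos (hk : 1 ≤ k) (hQ : IsDisjointPathsSolution Q)
    {i : Fin (k + 1)} {v w : InstVertex k} (hl : (rowLetter k (coord v).1).1 = k - i.val)
    (hw : _root_.nextPos k (coord v) = some (coord w)) :
    ∃ d ∈ (Q i).1.darts, d.fst = v ∧ d.snd = w := by
  obtain ⟨j, hj, y, hy, h⟩ := hQ.exists_step hk v
  obtain rfl : i = j := by
    have := i.isLt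
    have := j.isLt
    apply Fin.ext
    omega
  rw [hw] at hy
  obtain ⟨w', rfl, hw'⟩ := map_coord_eq_some hy
  obtain rfl := coord_injective k hw'
  exact h

theorem IsDisjointPathsSolution.nextPos_eq (hk : 1 ≤ k) (hQ : IsDisjointPathsSolution Q)
    {i : Fin (k + 1)} {d : (instGraph k).Dart} (hd : d ∈ (Q i).1.darts) :
    _root_.nextPos k (coord d.fst) = some (coord d.snd) := by
  obtain ⟨j, hj, y, hy, h⟩ := hQ.exists_step hk d.fst
  have h' : (Q i).1.Step (some d.fst) (some d.snd) := ⟨d, hd, rfl, rfl⟩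
  obtain rfl := hQ.index_unique h.fst_mem h'.fst_mem
  obtain rfl := (Q j).2.step_out_unique h h'
  exact hy.symm

theorem IsDisjointPathsSolution.unique (hk : 1 ≤ k) {P : ∀ i : Fin (k + 1),
    (instGraph k).Path (termS k i) (termT k i)} (hQ : IsDisjointPathsSolution Q)
    (hP : IsDisjointPathsSolution P) : Q = P := by
  funext i
  apply Subtype.ext
  exact (Q i).2.eq_of_forall_dart (f := fun v => _root_.nextPos k (coord v))
    (c := fun v => some (coord v)) ((Option.some_injective _).comp (coord_injective k)) (P i).2
    (fun d hd => hQ.nextPos_eq hk hd) (fun d hd => hP.nextPos_eq hk hd)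

end Solution

/-! ### Existence by following the successor. -/

section Successor

variable {k : ℕ}

theorem rowLetter_of_leftSlot {r : ℕ} (h : ¬ IsLeftTerminal r) :
    ∃ r', leftSlot r = some (r', 0) ∧ leftSlot r' = some (r, 0) ∧ r' < 2 * r ∧
      rowLetter k r' = ((rowLetter k r).1, !(rowLetter k r).2) ∧
      ∃ a, r + r' = 6 * 2 ^ a ∧ 2 * 2 ^ a < r ∧ 2 * 2 ^ a < r' ∧ r ≠ r' := by
  obtain ⟨a, r', h1, h2, h3, h4, h5⟩ := exists_leftSlot_eq_some h
  refine ⟨r', h1, leftSlot_eq_some (by omega) h4 h3 h5.symm, by omega, ?_, a, h2, h3, h4, h5⟩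
  rw [rowLetter_of_pos (by omega), rowLetter_of_pos (by omega)]
  exact dyadicLetter_reflect (c := a) (n := 1) (by omega) (by omega) (by omega) h5

theorem rowLetter_right (hk : 1 ≤ k) {r : ℕ} (hr : r ≤ 2 ^ k) (h : 2 * r ≠ 2 ^ k) :
    rowLetter k (2 ^ k - r) = ((rowLetter k r).1, !(rowLetter k r).2) := by
  obtain ⟨k, rfl⟩ := Nat.exists_eq_add_of_le' hk
  have hpow : 2 ^ (k + 1) = 2 * 2 ^ k := by rw [pow_succ, mul_comm]
  have hpos : 0 < 2 ^ k := by positivity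
  rcases Nat.eq_zero_or_pos r with rfl | h0
  -- Rows `0` and `2 ^ k` are mirror images outside the range of `dyadicLetter_reflect`; the
  -- convention for row `0` makes their letters inverse.
  · rw [Nat.sub_zero, rowLetter_of_pos (by omega), dyadicLetter_two_pow]
    rfl
  · rcases hr.eq_or_lt with rfl | hr
    · rw [Nat.sub_self, rowLetter_of_pos h0, dyadicLetter_two_pow]
      rfl
    · rw [rowLetter_of_pos h0, rowLetter_of_pos (by omega)]
      exact dyadicLetter_reflect (c := k) (n := 0) (by omega) (by omega) (by omega) (by omega)

/-- The predecessor of a vertex on the paths of the solution. -/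
noncomputable def prevPos (k : ℕ) (p : ℕ × ℕ) : Option (ℕ × ℕ) :=
  if (rowLetter k p.1).2 then (if 0 < p.2 then some (p.1, p.2 - 1) else leftSlot p.1)
  else (if p.2 < 2 ^ k then some (p.1, p.2 + 1) else rightSlot k p.1)

theorem prevPos_source {a : ℕ} : prevPos k (2 ^ a, 0) = none := by
  unfold prevPos
  rw [rowLetter_of_pos (by positivity), dyadicLetter_two_pow]
  simp [leftSlot_two_pow]

/-- Additional edges join rows of the same level and opposite direction, so the successor keeps the
level and is inverted by `prevPos`; it fails to exist only at the target of that level. -/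
theorem nextPos_cases (hk : 1 ≤ k) {p : ℕ × ℕ} (h1 : p.1 ≤ 2 ^ k) (h2 : p.2 ≤ 2 ^ k) :
    (nextPos k p = none ∧ p = targetPos k (rowLetter k p.1).1) ∨
      ∃ q, nextPos k p = some q ∧ prevPos k q = some p ∧ GridAdj k p q ∧
        (rowLetter k q.1).1 = (rowLetter k p.1).1 := by
  obtain ⟨r, c⟩ := p
  simp only at h1 h2
  unfold nextPos
  rcases hs : rowLetter k r with ⟨a, _ | _⟩
  · simp only [Bool.false_eq_true, if_false]
    split_ifs with hc
    · right
      refine ⟨_, rfl, ?_, ⟨⟨h1, h2, h1, ?_⟩, Or.inl ⟨rfl, Or.inr ?_⟩⟩, by rw [hs]⟩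
      · unfold prevPos
        simp only [hs, Bool.false_eq_true, if_false]
        rw [if_pos (by omega), Nat.sub_add_cancel hc]
      · simp only; omega
      · simp only; omega
    · obtain rfl : c = 0 := by omega
      by_cases ht : IsLeftTerminal r
      · left
        refine ⟨if_pos ht, ?_⟩
        rcases ht with rfl | ⟨b, rfl⟩ | ⟨b, rfl⟩
        · rw [rowLetter_zero] at hs
          obtain rfl := (Prod.mk.inj hs).1
          simp [targetPos]
        · rw [rowLetter_of_pos (by positivity), dyadicLetter_two_pow] at hs
          simp at hs
        · have hp : 0 < 2 ^ b := by positivity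
          rw [rowLetter_of_pos (by positivity), dyadicLetter_three_mul_two_pow] at hs
          obtain rfl := (Prod.mk.inj hs).1
          have hb : 2 ^ (b + 1) < 2 ^ k := by rw [pow_succ]; omega
          rw [two_pow_lt_two_pow_iff] at hb
          rw [targetPos, if_neg (by omega), if_neg (by omega)]
      · right
        obtain ⟨r', e1, e2, e3, e4, b, e5, e6, e7, e8⟩ := rowLetter_of_leftSlot (k := k) ht
        rw [hs] at e4
        -- Hence `4 * 2 ^ b ≤ 2 ^ k`, which keeps the partner row inside the grid.
        have hb : 2 ^ (b + 1) < 2 ^ k := by rw [pow_succ]; omega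
        rw [two_pow_lt_two_pow_iff] at hb
        have hb' : 2 ^ (b + 2) ≤ 2 ^ k := Nat.pow_le_pow_right (by norm_num) hb
        rw [pow_succ, pow_succ] at hb'
        refine ⟨_, e1, ?_, ⟨⟨h1, h2, ?_, h2⟩,
          Or.inr (Or.inr (Or.inl ⟨rfl, rfl, e8, b, e5, e6, e7⟩))⟩, by rw [e4]⟩
        · unfold prevPos
          rw [e4]
          simpa using e2
        · simp only; omega
  · simp only [if_true]
    split_ifs with hc
    · right
      refine ⟨_, rfl, ?_, ⟨⟨h1, h2, h1, ?_⟩, Or.inl ⟨rfl, Or.inl rfl⟩⟩, by rw [hs]⟩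
      · unfold prevPos
        simp [hs]
      · simp only; omega
    · obtain rfl : c = 2 ^ k := by omega
      by_cases ht : 2 * r = 2 ^ k
      · left
        refine ⟨if_pos ht, ?_⟩
        obtain ⟨k, rfl⟩ := Nat.exists_eq_add_of_le' hk
        obtain rfl : r = 2 ^ k := by rw [pow_succ] at ht; omega
        rw [rowLetter_of_pos (by positivity), dyadicLetter_two_pow] at hs
        obtain rfl := (Prod.mk.inj hs).1
        simp [targetPos]
      · right
        have e4 := rowLetter_right hk h1 ht
        rw [hs] at e4
        refine ⟨_, if_neg ht, ?_, ⟨⟨h1, h2, Nat.sub_le _ _, h2⟩,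
          Or.inr (Or.inr (Or.inr ⟨rfl, rfl, ?_, ?_⟩))⟩, by rw [e4]⟩
        · unfold prevPos
          simp only [e4, Bool.not_true, Bool.false_eq_true, if_false, lt_irrefl]
          rw [rightSlot, if_neg (by omega)]
          congr 2
          omega
        · simp only; omega
        · simp only; omega

/-- The successor function on the vertices of the instance. -/
noncomputable def nextVertex (k : ℕ) (v : InstVertex k) : Option (InstVertex k) :=
  (nextPos k (coord v)).map fun q => (Fin.ofNat _ q.1, Fin.ofNat _ q.2)

theorem nextVertex_cases (hk : 1 ≤ k) (v : InstVertex k) :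
    (nextVertex k v = none ∧ coord v = targetPos k (rowLetter k (coord v).1).1) ∨
      ∃ w, nextVertex k v = some w ∧ prevPos k (coord w) = some (coord v) ∧
        (instGraph k).Adj v w ∧ (rowLetter k (coord w).1).1 = (rowLetter k (coord v).1).1 := by
  rcases nextPos_cases hk (coord_fst_le v) (coord_snd_le v) with ⟨h1, h2⟩ | ⟨q, h1, h2, h3, h4⟩
  · left
    exact ⟨by rw [nextVertex, h1]; rfl, h2⟩
  · right
    have hq : coord (k := k) (Fin.ofNat _ q.1, Fin.ofNat _ q.2) = q := by
      have := h3.1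
      unfold coord
      simp only [Fin.val_ofNat]
      rw [Nat.mod_eq_of_lt (by omega), Nat.mod_eq_of_lt (by omega)]
    refine ⟨_, by rw [nextVertex, h1]; rfl, ?_, ?_, ?_⟩
    · rw [hq, h2]
    · rw [instGraph_adj_iff hk, hq]; exact h3
    · rw [hq, h4]

theorem exists_walk_of_level (hk : 1 ≤ k) (i : Fin (k + 1)) :
    ∃ w : (instGraph k).Walk (termS k i) (termT k i),
      ∀ x ∈ w.support, (rowLetter k (coord x).1).1 = k - i.val := by
  have hsome : ∀ x y, nextVertex k x = some y → prevPos k (coord y) = some (coord x) ∧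
      (instGraph k).Adj x y ∧ (rowLetter k (coord y).1).1 = (rowLetter k (coord x).1).1 := by
    intro x y hxy
    rcases nextVertex_cases hk x with ⟨h, _⟩ | ⟨w, h, h'⟩
    · rw [h] at hxy; exact absurd hxy (by simp)
    · obtain rfl := Option.some.inj (h.symm.trans hxy)
      exact h'
  refine exists_walk_of_successor (f := nextVertex k) ?_ ?_ ?_ ?_ ?_ ?_
  · intro x y z hx hy
    have := (hsome x z hx).1.symm.trans (hsome y z hy).1
    exact coord_injective k (Option.some.inj this)
  · intro x hx
    have := (hsome x _ hx).1
    rw [coord_termS, prevPos_source] at this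
    exact absurd this (by simp)
  · exact fun x y h => (hsome x y h).2.1
  · rw [coord_termS, rowLetter_of_pos (by positivity), dyadicLetter_two_pow]
  · intro x y hx h
    rw [(hsome x y h).2.2, hx]
  · intro x hx h
    rcases nextVertex_cases hk x with ⟨_, h'⟩ | ⟨w, h', _⟩
    · apply coord_injective k
      rw [h', hx, coord_termT]
    · rw [h'] at h; exact absurd h (by simp)

/-- Walks of different indices stay in rows of different levels, so they are disjoint; shortening
them to paths preserves this. -/
theorem exists_solution (hk : 1 ≤ k) :
    ∃ P : ∀ i : Fin (k + 1), (instGraph k).Path (termS k i) (termT k i),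
      IsDisjointPathsSolution P := by
  choose w hw using exists_walk_of_level hk
  refine ⟨fun i => (w i).toPath, fun i j hij x hi hj => hij ?_⟩
  have h1 := hw i x ((w i).support_toPath_subset_support hi)
  have h2 := hw j x ((w j).support_toPath_subset_support hj)
  have := i.isLt
  have := j.isLt
  apply Fin.ext
  omega

end Successor

/-! ### Counting the crossings. -/

section Count

variable {k : ℕ} {P : ∀ i : Fin (k + 1), (instGraph k).Path (termS k i) (termT k i)}

theorem mem_gridInner_iff (v : InstVertex k) :
    v ∈ gridInner (2 ^ k + 1) (2 ^ k + 1) ↔ (0 < (coord v).1 ∧ (coord v).1 < 2 ^ k) ∧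
      (0 < (coord v).2 ∧ (coord v).2 < 2 ^ k) := by
  unfold gridInner coord
  simp only [Set.mem_ofPred_eq]
  omega

theorem termS_notMem (i : Fin (k + 1)) : termS k i ∉ gridInner (2 ^ k + 1) (2 ^ k + 1) := by
  rw [mem_gridInner_iff, coord_termS]
  simp

theorem termT_notMem (i : Fin (k + 1)) : termT k i ∉ gridInner (2 ^ k + 1) (2 ^ k + 1) := by
  rw [mem_gridInner_iff, coord_termT]
  unfold targetPos
  split_ifs <;> simp

/-- The inner rows of level `a`. -/
def innerRows (k a : ℕ) : Finset ℕ :=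
  (Finset.range (2 ^ k)).filter fun r => 0 < r ∧ (dyadicLetter r).1 = a

theorem card_innerRows_self (k : ℕ) : (innerRows k k).card = 0 := by
  rw [Finset.card_eq_zero, innerRows, Finset.filter_eq_empty_iff]
  rintro r hr ⟨h0, h⟩
  have := dyadicLetter_fst_lt h0 (Finset.mem_range.1 hr)
  omega

theorem card_innerRows (a n : ℕ) : (innerRows (a + (n + 1)) a).card = 2 ^ n := by
  have h : innerRows (a + (n + 1)) a =
      (Finset.range (2 ^ n)).image fun m => 2 ^ a * (2 * m + 1) := by
    ext r
    have hpow : 2 ^ (a + (n + 1)) = 2 ^ a * (2 * 2 ^ n) := by ring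
    simp only [innerRows, Finset.mem_filter, Finset.mem_range, Finset.mem_image, hpow]
    constructor
    · rintro ⟨h1, h2, h3⟩
      obtain ⟨b, q, hq, rfl⟩ := exists_two_pow_mul_odd h2
      rw [dyadicLetter_mul hq] at h3
      obtain rfl : b = a := h3
      have := Nat.lt_of_mul_lt_mul_left h1
      exact ⟨q / 2, by omega, by rw [show 2 * (q / 2) + 1 = q by omega]⟩
    · rintro ⟨m, hm, rfl⟩
      refine ⟨Nat.mul_lt_mul_of_pos_left (by omega) (by positivity), by positivity, ?_⟩
      rw [dyadicLetter_mul (by omega)]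
  rw [h, Finset.card_image_of_injective, Finset.card_range]
  intro m m' hm
  have := Nat.eq_of_mul_eq_mul_left (by positivity) hm
  omega

/-- Additional edges end in border columns, so a step into an inner column is horizontal. -/
theorem nextPos_inner {p q : ℕ × ℕ} (h : nextPos k p = some q) (h0 : 0 < q.2)
    (hq : q.2 < 2 ^ k) :
    p.1 = q.1 ∧ q.2 = if (rowLetter k p.1).2 then p.2 + 1 else p.2 - 1 := by
  unfold nextPos at h
  split_ifs at h ⊢ with h1 h2 h2
  · obtain rfl := Option.some.inj h
    exact ⟨rfl, rfl⟩
  · unfold rightSlot at h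
    split_ifs at h
    obtain rfl := Option.some.inj h
    simp at hq
  · obtain rfl := Option.some.inj h
    exact ⟨rfl, rfl⟩
  · unfold leftSlot at h
    split_ifs at h
    obtain rfl := Option.some.inj h
    simp at h0

/-- Sending an entering dart to its row is a bijection onto the inner rows of the level: such a row
is entered exactly once, from the border column where its direction starts. -/
theorem IsDisjointPathsSolution.enterCount_eq (hk : 1 ≤ k) (hP : IsDisjointPathsSolution P)
    (i : Fin (k + 1)) :
    enterCount (gridInner (2 ^ k + 1) (2 ^ k + 1)) (P i).1 =
      (innerRows k (k - i.val)).card := by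
  classical
  set I := gridInner (2 ^ k + 1) (2 ^ k + 1) with hI
  have hN : 2 ≤ 2 ^ k := by
    calc 2 = 2 ^ 1 := rfl
      _ ≤ 2 ^ k := Nat.pow_le_pow_right (by norm_num) hk
  set L := (P i).1.darts.filter fun d => d.fst ∉ I ∧ d.snd ∈ I with hL
  have hmem : ∀ d ∈ L, d ∈ (P i).1.darts ∧ (coord d.fst).1 = (coord d.snd).1 ∧
      (0 < (coord d.fst).1 ∧ (coord d.fst).1 < 2 ^ k) ∧
      (coord d.fst).2 = if (rowLetter k (coord d.fst).1).2 then 0 else 2 ^ k := by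
    intro d hd
    rw [hL, List.mem_filter, decide_eq_true_iff, hI, mem_gridInner_iff, mem_gridInner_iff] at hd
    obtain ⟨hd, h1, h2, h3⟩ := hd
    obtain ⟨h4, h5⟩ := nextPos_inner (hP.nextPos_eq hk hd) h3.1 h3.2
    have h6 := coord_snd_le d.fst
    refine ⟨hd, h4, by omega, ?_⟩
    split_ifs at h5 ⊢ <;> omega
  have hnodup : (L.map fun d => (coord d.fst).1).Nodup := by
    refine List.Nodup.map_on ?_ ((SimpleGraph.Walk.darts_nodup_of_support_nodup
      (P i).2.support_nodup).filter _)
    intro d hd d' hd' h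
    obtain ⟨h1, h2, h3, h4⟩ := hmem d hd
    obtain ⟨h1', h2', h3', h4'⟩ := hmem d' hd'
    refine (P i).2.dart_ext_fst h1 h1' (coord_injective k (Prod.ext h ?_))
    rw [h4, h4', h]
  have hset : (L.map fun d => (coord d.fst).1).toFinset = innerRows k (k - i.val) := by
    ext r
    simp only [List.mem_toFinset, List.mem_map, innerRows, Finset.mem_filter, Finset.mem_range]
    constructor
    · rintro ⟨d, hd, rfl⟩
      obtain ⟨h1, h2, h3, h4⟩ := hmem d hd
      refine ⟨h3.2, h3.1, ?_⟩
      rw [← rowLetter_of_pos (k := k) h3.1]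
      exact hP.level_eq hk ((P i).1.dart_fst_mem_support_of_mem_darts h1)
    · rintro ⟨h1, h2, h3⟩
      rw [← rowLetter_of_pos (k := k) h2] at h3
      obtain ⟨v, hv⟩ := exists_coord_eq (k := k)
        (p := (r, if (rowLetter k r).2 then 0 else 2 ^ k)) h1.le (by simp only; split_ifs <;> omega)
      obtain ⟨w, hw⟩ := exists_coord_eq (k := k)
        (p := (r, if (rowLetter k r).2 then 1 else 2 ^ k - 1)) h1.le
        (by simp only; split_ifs <;> omega)
      obtain ⟨d, hd, rfl, rfl⟩ := hP.step_of_nextPos hk (i := i) (v := v) (w := w)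
        (by rw [hv]; exact h3) (by
          rw [hv, hw]
          unfold _root_.nextPos
          simp only
          split_ifs <;> first | rfl | omega)
      refine ⟨d, ?_, by rw [hv]⟩
      rw [hL, List.mem_filter, decide_eq_true_iff, hI, mem_gridInner_iff, mem_gridInner_iff, hv, hw]
      refine ⟨hd, ?_, ⟨h2, h1⟩, ?_⟩
      · rintro ⟨_, h⟩
        simp only at h
        split_ifs at h <;> omega
      · simp only
        split_ifs <;> omega
  rw [← hset, List.toFinset_card_of_nodup hnodup, List.length_map, hL]
  unfold enterCount
  rw [List.countP_eq_length_filter]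

theorem IsDisjointPathsSolution.crossingNumber_eq (hk : 1 ≤ k) (hP : IsDisjointPathsSolution P)
    (i : Fin (k + 1)) :
    crossingNumber (gridInner (2 ^ k + 1) (2 ^ k + 1)) (P i).1 =
      if i.val = 0 then 0 else 2 ^ (i.val - 1) := by
  rw [crossingNumber_eq_enterCount _ (termS_notMem i) (termT_notMem i), hP.enterCount_eq hk]
  have hi := i.isLt
  split_ifs with h
  · rw [h, Nat.sub_zero, card_innerRows_self]
  · have := card_innerRows (k - i.val) (i.val - 1)
    rwa [show k - i.val + (i.val - 1 + 1) = k by omega] at this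

end Count

theorem mainTheorem1 (k : ℕ) (hk : 1 ≤ k) :
    ∃ P : ∀ i : Fin (k + 1), (instGraph k).Path (termS k i) (termT k i),
      IsDisjointPathsSolution P ∧
      (∀ Q : ∀ i : Fin (k + 1), (instGraph k).Path (termS k i) (termT k i),
        IsDisjointPathsSolution Q → Q = P) ∧
      (∀ v : InstVertex k, ∃ i, v ∈ (P i).1.support) ∧
      crossingNumber (gridInner (2 ^ k + 1) (2 ^ k + 1)) (P 0).1 = 0 ∧
      (∀ i : Fin (k + 1), 1 ≤ i.val →
        crossingNumber (gridInner (2 ^ k + 1) (2 ^ k + 1)) (P i).1 = 2 ^ (i.val - 1)) ∧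
      ∑ i : Fin (k + 1), crossingNumber (gridInner (2 ^ k + 1) (2 ^ k + 1)) (P i).1 =
        2 ^ k - 1 := by
  obtain ⟨P, hP⟩ := exists_solution hk
  refine ⟨P, hP, fun Q hQ => hQ.unique hk hP, fun v => ?_, ?_, fun i hi => ?_, ?_⟩
  -- Covering comes from the forced letters of an arbitrary solution, not from the construction of
  -- `P`.
  · obtain ⟨i, _, y, _, h⟩ := hP.exists_step hk v
    exact ⟨i, h.fst_mem⟩
  · rw [hP.crossingNumber_eq hk]
    rfl
  · rw [hP.crossingNumber_eq hk, if_neg (by omega)]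
  · simp only [hP.crossingNumber_eq hk]
    rw [Fin.sum_univ_succ]
    simp only [Fin.val_zero, if_true, Fin.val_succ, Nat.add_sub_cancel, zero_add]
    rw [Finset.sum_congr rfl fun i _ => if_neg (Nat.succ_ne_zero _),
      Fin.sum_univ_eq_sum_range (fun i => 2 ^ i) k, Nat.geomSum_eq le_rfl]
    simp
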